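/- Consider a plane geometry given by points, lines, a relation of incidence, a betweenness relation $(ABC)$ ("$B$ lies between $A$ and $C$"), and relations $\cong$ of congruence between segments and between angles. Here a segment $AB$ is the unordered pair of distinct endpoints $A,B$; for $A\neq O$ the ray $OA$ consists of the points $X\ne O$ of the line $OA$ for which $(XOA)$ is false; an angle $\angle AOB$ (with $A,O,B$ noncollinear) is the unordered pair of the rays $OA$, $OB$; and for a point $S$ not on a line $g$ the half plane of $g$ containing $S$ consists of the points $X$ not on $g$ such that no point of $g$ lies between $S$ and $X$. Two lines are called parallel ($\parallel$) if they have no common point. Suppose that Hilbert's plane axioms I–IV hold, no continuity axiom (such as that of Archimedes) being assumed: - (Incidence) Any two distinct points lie on exactly one line; every line contains at least two points; there are three noncollinear points. - (Order) If $(ABC)$, then $A,B,C$ are three distinct collinear points and $(CBA)$. For any distinct $A,B$ there is $C$ with $(ABC)$. Of three points, at most one lies between the other two. If $A,B,C$ are noncollinear and a line through none of $A,B,C$ contains a point between $A$ and $B$, then it contains a point between $A$ and $C$ or a point between $B$ and $C$. - (Congruence) For every segment $AB$ and every ray with origin $A'$ there is a point $B'$ on this ray with $AB\cong A'B'$. If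 $A_1B_1\cong AB$ and $A_2B_2\cong AB$, then $A_1B_1\cong A_2B_2$. If $(ABC)$, $(A'B'C')$, $AB\cong A'B'$ and $BC\cong B'C'$, then $AC\cong A'C'$. Every angle is congruent to itself. For every angle $\angle AOB$, every ray $O'A'$ and every half plane of the line $O'A'$ there is exactly one ray $r$ with origin $O'$ in this half plane such that $\angle AOB$ is congruent to the angle with arms $O'A'$ and $r$. If $ABC$ and $A'B'C'$ are triangles with $AB\cong A'B'$, $AC\cong A'C'$ and $\angle BAC\cong\angle B'A'C'$, then $\angle ABC\cong\angle A'B'C'$. - (Parallel postulate) Through a point outside a line $g$ there is at most one line that does not meet $g$. Then the affine Pappus theorem holds: let $g$ and $g'$ be lines (intersecting or parallel), let $A,B,C$ be points of $g$ not on $g'$, and let $A',B',C'$ be points of $g'$ not on $g$, with $A\neq B$. If $BC'\parallel B'C$ and $AC'\parallel A'C$, then $AB'\parallel A'B$. -/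

import Mathlib

/-- The primitive notions of plane geometry: two sorts of things, points and lines, with
incidence, betweenness, congruence of segments and congruence of angles.
A segment is given by the unordered pair of its endpoints, an angle by the unordered
pair of its two arms (rays, which are sets of points). -/
structure PlaneGeometry (Point Line : Type*) where
  /-- `inc A g`: the point `A` lies on the line `g`. -/
  inc : Point → Line → Prop
  /-- `btw A B C`: the point `B` lies between `A` and `C`. -/
  btw : Point → Point → Point → Prop
  /-- congruence of segments -/
  segCongr : Sym2 Point → Sym2 Point → Prop
  /-- congruence of angles -/
  angCongr : Sym2 (Set Point) → Sym2 (Set Point) → Prop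

namespace PlaneGeometry

variable {Point Line : Type*} (G : PlaneGeometry Point Line)

/-- The points `A`, `B`, `C` lie on a common line. -/
def Collinear (A B C : Point) : Prop :=
  ∃ g : Line, G.inc A g ∧ G.inc B g ∧ G.inc C g

/-- For `A ≠ O`, the half line with origin `O` through `A` (origin excluded): the points of
the line `OA` that lie on the same side of `O` as `A`. -/
def ray (O A : Point) : Set Point :=
  {X | X ≠ O ∧ G.Collinear O A X ∧ ¬ G.btw X O A}

/-- For `S` not on `g`, the half plane of `g` containing `S`: the points `X` outside `g` such
that the segment `SX` contains no point of `g`. -/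
def halfPlane (g : Line) (S : Point) : Set Point :=
  {X | ¬ G.inc X g ∧ ∀ Y, G.inc Y g → ¬ G.btw S Y X}

/-- The angle `∠ A O B` with vertex `O`: the unordered pair of the rays `OA` and `OB`. -/
def angle (A O B : Point) : Sym2 (Set Point) :=
  s(G.ray O A, G.ray O B)

/-- Two lines are parallel if they have no point in common. -/
def Parallel (g h : Line) : Prop :=
  ∀ X, ¬ (G.inc X g ∧ G.inc X h)

/-- The plane axioms of incidence. -/
structure IncidenceAxioms : Prop where
  /-- Two distinct points have a connecting line. -/
  exists_line : ∀ A B : Point, A ≠ B → ∃ g : Line, G.inc A g ∧ G.inc B g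
  /-- Two distinct points have at most one connecting line. -/
  line_unique : ∀ (A B : Point) (g h : Line), A ≠ B →
    G.inc A g → G.inc B g → G.inc A h → G.inc B h → g = h
  /-- On every line there are at least two points. -/
  two_points : ∀ g : Line, ∃ A B : Point, A ≠ B ∧ G.inc A g ∧ G.inc B g
  /-- There are three points that do not lie on one line. -/
  three_points : ∃ A B C : Point, ¬ G.Collinear A B C

/-- The plane axioms of order. -/
structure OrderAxioms : Prop where
  /-- If `B` is between `A` and `C`, then `A`, `B`, `C` are three different points on a line. -/
  btw_distinct : ∀ A B C : Point, G.btw A B C →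
    A ≠ B ∧ B ≠ C ∧ A ≠ C ∧ G.Collinear A B C
  /-- Betweenness is symmetric in the endpoints. -/
  btw_symm : ∀ A B C : Point, G.btw A B C → G.btw C B A
  /-- Every segment can be extended beyond an endpoint. -/
  btw_extend : ∀ A B : Point, A ≠ B → ∃ C, G.btw A B C
  /-- Of three points at most one is between the other two. -/
  btw_unique : ∀ A B C : Point, G.btw A B C → ¬ G.btw B A C ∧ ¬ G.btw A C B
  /-- A line that passes through none of the vertices of a triangle, but through a point of one
  side, passes through a point of one of the other two sides. -/
  pasch : ∀ (A B C : Point) (g : Line), ¬ G.Collinear A B C →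
    ¬ G.inc A g → ¬ G.inc B g → ¬ G.inc C g →
    (∃ X, G.inc X g ∧ G.btw A X B) →
    (∃ X, G.inc X g ∧ G.btw A X C) ∨ (∃ X, G.inc X g ∧ G.btw B X C)

/-- The plane axioms of congruence. -/
structure CongruenceAxioms : Prop where
  /-- A segment can be transported to every half line, starting at its origin. -/
  seg_transport : ∀ A B A' C' : Point, A ≠ B → A' ≠ C' →
    ∃ B' ∈ G.ray A' C', G.segCongr s(A, B) s(A', B')
  /-- Segments congruent to the same segment are congruent. -/
  seg_trans : ∀ A B A₁ B₁ A₂ B₂ : Point, A ≠ B → A₁ ≠ B₁ → A₂ ≠ B₂ →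
    G.segCongr s(A₁, B₁) s(A, B) → G.segCongr s(A₂, B₂) s(A, B) →
    G.segCongr s(A₁, B₁) s(A₂, B₂)
  /-- Additivity of segments. -/
  seg_add : ∀ A B C A' B' C' : Point, G.btw A B C → G.btw A' B' C' →
    G.segCongr s(A, B) s(A', B') → G.segCongr s(B, C) s(B', C') →
    G.segCongr s(A, C) s(A', C')
  /-- Every angle is congruent to itself. -/
  ang_refl : ∀ A O B : Point, ¬ G.Collinear A O B →
    G.angCongr (G.angle A O B) (G.angle A O B)
  /-- Transport of angles: given an angle `∠ A O B`, a half line `O'A'` of a line `g'` and a half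
  plane of `g'`, there is exactly one half line `r` from `O'` in this half plane such that
  `∠ A O B` is congruent to the angle formed by `O'A'` and `r`. -/
  ang_transport : ∀ (A O B O' A' S : Point) (g' : Line), ¬ G.Collinear A O B → O' ≠ A' →
    G.inc O' g' → G.inc A' g' → ¬ G.inc S g' →
    ∃! r : Set Point, (∃ B' ∈ G.halfPlane g' S, r = G.ray O' B') ∧
      G.angCongr (G.angle A O B) s(G.ray O' A', r)
  /-- The weak congruence theorem. -/
  sas : ∀ A B C A' B' C' : Point, ¬ G.Collinear A B C → ¬ G.Collinear A' B' C' →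
    G.segCongr s(A, B) s(A', B') → G.segCongr s(A, C) s(A', C') →
    G.angCongr (G.angle B A C) (G.angle B' A' C') →
    G.angCongr (G.angle A B C) (G.angle A' B' C')

/-- The parallel postulate: through a point outside a line there is at most one line that does
not meet the given line. -/
def ParallelAxiom : Prop :=
  ∀ (P : Point) (g h k : Line), ¬ G.inc P g → G.inc P h → G.inc P k →
    G.Parallel g h → G.Parallel g k → h = k

end PlaneGeometry

namespace PlaneGeometry

/-! The proof is the classical one by concyclic quadrangles. If `X`, `Y` on `g` and `Z`, `W` on `g'`
lie on a circle, then `XZ` and `YW` are antiparallel with respect to `g` and `g'`, and conversely;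
so the other pair `XW`, `YZ` is antiparallel too. Choose `D` on `g'` with `AD` antiparallel to
`BC'`. From `A, B, C', D` one gets `AC'`, hence its parallel `A'C`, antiparallel to `BD`; then `B,
C, A', D` make `A'B` antiparallel to `CD`. Since `B'C` is parallel to `BC'`, it is antiparallel to
`AD`; then `A, C, B', D` make `AB'` antiparallel to `CD`. So `AB'` and `A'B` have the same
direction.

Angles are replaced by line reflections: for lines `u`, `v`, `h`, `h'` through one point with the
directions of `XZ`, `YW`, `g`, `g'`, antiparallelism is the equation `refl u * refl h * refl v =
refl h'`. This covers intersecting and parallel `g`, `g'` at once, and the direction of `YW` is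
determined by the other three. The link with circles is that perpendicular bisectors through the
centre obey the theorem of three reflections (`three_refl`, `antiparallel_of_concyclic`,
`antiparallel_swap`).

Without continuity no circle may be intersected with a line. The centre is the meet of two
perpendicular bisectors, and the second point on `g'` is the reflection of the first. The main
preliminary is therefore that any two points have a perpendicular bisector (`exists_mirror`) and
that reflections preserve length (`Mir.len_eq`). -/

/-- A plane satisfying Hilbert's axioms of incidence, order and congruence. -/
class HilbertPlane {Point Line : Type*} (G : PlaneGeometry Point Line) : Prop where
  nonempty_line : Nonempty Line
  incidence : G.IncidenceAxioms
  order : G.OrderAxioms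
  congruence : G.CongruenceAxioms

theorem ne_of_inc {Point Line : Type*} {G : PlaneGeometry Point Line} {A B : Point} {g : Line} (h1 : G.inc A g) (h2 : ¬ G.inc B g) : A ≠ B := by
  rintro rfl; exact h2 h1

/-! ### Order: the two sides of a line and of a point on a line. -/

section Order

set_option linter.unusedSectionVars false

variable {Point Line : Type*} {G : PlaneGeometry Point Line} [HilbertPlane G]

theorem exists_line {A B : Point} (h : A ≠ B) : ∃ g, G.inc A g ∧ G.inc B g :=
  HilbertPlane.incidence.exists_line A B h

theorem line_unique {A B : Point} {g h : Line} (hAB : A ≠ B) (h1 : G.inc A g) (h2 : G.inc B g)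
    (h3 : G.inc A h) (h4 : G.inc B h) : g = h :=
  HilbertPlane.incidence.line_unique A B g h hAB h1 h2 h3 h4

theorem inter_unique {A B : Point} {g h : Line} (hgh : g ≠ h) (h1 : G.inc A g) (h2 : G.inc A h)
    (h3 : G.inc B g) (h4 : G.inc B h) : A = B := by
  by_contra hAB
  exact hgh (line_unique hAB h1 h3 h2 h4)

theorem collinear_iff {A B C : Point} {g : Line} (h : A ≠ B) (hA : G.inc A g) (hB : G.inc B g) :
    G.Collinear A B C ↔ G.inc C g := by
  constructor
  · rintro ⟨k, h1, h2, h3⟩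
    rwa [line_unique h hA hB h1 h2]
  · exact fun hC => ⟨g, hA, hB, hC⟩

theorem not_collinear {A B C : Point} {g : Line} (h : A ≠ B) (hA : G.inc A g) (hB : G.inc B g)
    (hC : ¬ G.inc C g) : ¬ G.Collinear A B C := by
  rwa [collinear_iff h hA hB]


theorem exists_not_inc (g : Line) : ∃ P, ¬ G.inc P g := by
  obtain ⟨A, B, C, h⟩ := HilbertPlane.incidence (G := G).three_points
  by_contra! hg
  exact h ⟨g, hg A, hg B, hg C⟩

theorem exists_inc_ne (g : Line) (A : Point) : ∃ B, B ≠ A ∧ G.inc B g := by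
  obtain ⟨B, C, h, hB, hC⟩ := HilbertPlane.incidence (G := G).two_points g
  by_cases hBA : B = A
  · exact ⟨C, by rintro rfl; exact h hBA, hC⟩
  · exact ⟨B, hBA, hB⟩

theorem line_ext {g h : Line} (H : ∀ X, G.inc X g → G.inc X h) : g = h := by
  obtain ⟨B, C, hn, hB, hC⟩ := HilbertPlane.incidence (G := G).two_points g
  exact line_unique hn hB hC (H _ hB) (H _ hC)

theorem btw_symm {A B C : Point} (h : G.btw A B C) : G.btw C B A :=
  HilbertPlane.order.btw_symm A B C h

theorem btw_ne_left {A B C : Point} (h : G.btw A B C) : A ≠ B :=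
  (HilbertPlane.order.btw_distinct A B C h).1

theorem btw_ne_right {A B C : Point} (h : G.btw A B C) : B ≠ C :=
  (HilbertPlane.order.btw_distinct A B C h).2.1

theorem btw_ne {A B C : Point} (h : G.btw A B C) : A ≠ C :=
  (HilbertPlane.order.btw_distinct A B C h).2.2.1

theorem btw_collinear {A B C : Point} (h : G.btw A B C) : G.Collinear A B C :=
  (HilbertPlane.order.btw_distinct A B C h).2.2.2

theorem btw_inc_right {A B C : Point} {g : Line} (h : G.btw A B C) (hA : G.inc A g)
    (hB : G.inc B g) : G.inc C g :=
  (collinear_iff (btw_ne_left h) hA hB).1 (btw_collinear h)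

theorem btw_inc_left {A B C : Point} {g : Line} (h : G.btw A B C) (hB : G.inc B g)
    (hC : G.inc C g) : G.inc A g :=
  btw_inc_right (btw_symm h) hC hB

theorem btw_inc_mid {A B C : Point} {g : Line} (h : G.btw A B C) (hA : G.inc A g)
    (hC : G.inc C g) : G.inc B g := by
  obtain ⟨k, h1, h2, h3⟩ := btw_collinear h
  rwa [line_unique (btw_ne h) hA hC h1 h3]

theorem btw_not_left {A B C : Point} (h : G.btw A B C) : ¬ G.btw B A C :=
  (HilbertPlane.order.btw_unique A B C h).1

theorem btw_not_right {A B C : Point} (h : G.btw A B C) : ¬ G.btw A C B :=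
  (HilbertPlane.order.btw_unique A B C h).2

theorem btw_extend {A B : Point} (h : A ≠ B) : ∃ C, G.btw A B C :=
  HilbertPlane.order.btw_extend A B h

/-- The segment `AB` meets the line `g`. -/
def Opp (G : PlaneGeometry Point Line) (g : Line) (A B : Point) : Prop :=
  ∃ Y, G.inc Y g ∧ G.btw A Y B

theorem Opp.symm {g : Line} {A B : Point} (h : G.Opp g A B) : G.Opp g B A :=
  let ⟨Y, h1, h2⟩ := h; ⟨Y, h1, btw_symm h2⟩

theorem not_opp_self {g : Line} {A : Point} : ¬ G.Opp g A A :=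
  fun ⟨_, _, h⟩ => btw_ne h rfl

theorem opp_split_of_not_collinear {A B C : Point} {g : Line} (h : ¬ G.Collinear A B C)
    (hA : ¬ G.inc A g) (hB : ¬ G.inc B g) (hC : ¬ G.inc C g) (hAB : G.Opp g A B) :
    G.Opp g A C ∨ G.Opp g B C :=
  HilbertPlane.order.pasch A B C g h hA hB hC hAB

/-- If `C`, `Q`, `P` are on a line with `btw Q C P` and `Q ∈ g`, then `C` and `P` lie on the same
side of `g`. -/
theorem not_opp_of_btw {Q C P : Point} {g : Line} (hC : ¬ G.inc C g) (hQ : G.inc Q g)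
    (h : G.btw Q C P) : ¬ G.inc P g ∧ ¬ G.Opp g C P := by
  refine ⟨fun hP => hC (btw_inc_mid h hQ hP), ?_⟩
  rintro ⟨Y, hY, hb⟩
  obtain ⟨k, h1, h2, h3⟩ := btw_collinear h
  have hkg : k ≠ g := by rintro rfl; exact hC h2
  have : Y = Q := inter_unique hkg (btw_inc_mid hb h2 h3) hY h1 hQ
  subst this
  exact btw_not_left h hb

/-- Every point of the plane off `g` can be moved on the same side of `g` off a given line. -/
theorem exists_same_side_not_inc {C : Point} {g k : Line} (hC : ¬ G.inc C g) (hCk : G.inc C k) :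
    ∃ P, ¬ G.inc P k ∧ ¬ G.inc P g ∧ ¬ G.Opp g C P := by
  have : ∃ Q, G.inc Q g ∧ ¬ G.inc Q k := by
    by_contra! H
    exact hC (line_ext (G := G) H ▸ hCk)
  obtain ⟨Q, hQ, hQk⟩ := this
  obtain ⟨P, hP⟩ := btw_extend (G := G) (ne_of_inc hQ hC)
  obtain ⟨h1, h2⟩ := not_opp_of_btw hC hQ hP
  exact ⟨P, fun h => hQk (btw_inc_left hP hCk h), h1, h2⟩

/-- Pasch's axiom covers noncollinear points only. In the collinear case `C` is replaced by a point
`P` off the line but on the same side of `g`; Pasch for `A, B, P` and then for `X, P, C` gives the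
claim. -/
theorem opp_split {A B C : Point} {g : Line}
    (hA : ¬ G.inc A g) (hB : ¬ G.inc B g) (hC : ¬ G.inc C g) (hAB : G.Opp g A B) :
    G.Opp g A C ∨ G.Opp g B C := by
  by_cases h : G.Collinear A B C
  swap
  · exact opp_split_of_not_collinear h hA hB hC hAB
  obtain ⟨k, h1, h2, h3⟩ := h
  obtain ⟨P, hPk, hP, hCP⟩ := exists_same_side_not_inc hC h3
  have hne : A ≠ B := by obtain ⟨Y, _, h⟩ := hAB; exact btw_ne h
  by_cases hAC : A = C
  · subst hAC; exact Or.inr hAB.symm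
  by_cases hBC : B = C
  · subst hBC; exact Or.inl hAB
  have key : ∀ {X : Point}, G.inc X k → ¬ G.inc X g → X ≠ C → G.Opp g X P → G.Opp g X C := by
    intro X hX hXg hXC hXP
    have : ¬ G.Collinear X P C := fun ⟨m, m1, m2, m3⟩ =>
      hPk (line_unique hXC m1 m3 hX h3 ▸ m2)
    rcases opp_split_of_not_collinear this hXg hP hC hXP with h | h
    · exact h
    · exact absurd h.symm hCP
  rcases opp_split_of_not_collinear (not_collinear hne h1 h2 hPk) hA hB hP hAB with h | h
  · exact Or.inl (key h1 hA hAC h)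
  · exact Or.inr (key h2 hB hBC h)

/-- Of three points on a line, one lies between the other two. -/
theorem btw_trichotomy {A B C : Point} (h : G.Collinear A B C) (hAB : A ≠ B) (hBC : B ≠ C)
    (hAC : A ≠ C) : G.btw A B C ∨ G.btw B A C ∨ G.btw A C B := by
  by_contra! H
  obtain ⟨H1, H2, H3⟩ := H
  obtain ⟨k, hA, hB, hC⟩ := h
  obtain ⟨D, hD⟩ := exists_not_inc (G := G) k
  obtain ⟨m, hBm, hDm⟩ := exists_line (G := G) (ne_of_inc hB hD)
  obtain ⟨a, hAa, hDa⟩ := exists_line (G := G) (ne_of_inc hA hD)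
  obtain ⟨c, hCc, hDc⟩ := exists_line (G := G) (ne_of_inc hC hD)
  -- Pasch is applied repeatedly. Since `A` is not between `B` and `C`, line `AD` meets `XC` in a
  -- point `E`; since `C` is not between `A` and `B`, `D` turns out to lie between `A` and `E`. Line
  -- `BD` then enters triangle `AEC` at `D` and can leave it only at `B`, between `A` and `C`.
  obtain ⟨X, hX⟩ := btw_extend (G := G) (ne_of_inc hB hD)
  have hXm := btw_inc_right hX hBm hDm
  have hkm : k ≠ m := by rintro rfl; exact hD hDm
  have hka : k ≠ a := by rintro rfl; exact hD hDa
  have hkc : k ≠ c := by rintro rfl; exact hD hDc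
  have hXk : ¬ G.inc X k := fun h => btw_ne hX (inter_unique hkm hB hBm h hXm)
  have hAm : ¬ G.inc A m := fun h => hAB (inter_unique hkm hA h hB hBm)
  have hCm : ¬ G.inc C m := fun h => hBC (inter_unique hkm hB hBm hC h)
  have hma : m ≠ a := by rintro rfl; exact hAm hAa
  have hmc : m ≠ c := by rintro rfl; exact hCm hCc
  have hBa : ¬ G.inc B a := fun h => hAB (inter_unique hka hA hAa hB h)
  have hCa : ¬ G.inc C a := fun h => hAC (inter_unique hka hA hAa hC h)
  have hAc : ¬ G.inc A c := fun h => hAC (inter_unique hkc hA h hC hCc)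
  have hBc : ¬ G.inc B c := fun h => hBC (inter_unique hkc hB h hC hCc)
  have hXa : ¬ G.inc X a := fun h => btw_ne_right hX (inter_unique hma hDm hDa hXm h)
  have hXc : ¬ G.inc X c := fun h => btw_ne_right hX (inter_unique hmc hDm hDc hXm h)
  have hac : a ≠ c := by rintro rfl; exact hAc hAa
  have hE : G.Opp a X C := by
    rcases opp_split hBa hXa hCa ⟨D, hDa, hX⟩ with h | h
    · obtain ⟨Y, hY, hb⟩ := h
      have : Y = A := inter_unique hka (btw_inc_mid hb hB hC) hY hA hAa
      subst this
      exact absurd hb H2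
    · exact h
  have hF : G.Opp c X A := by
    rcases opp_split hBc hXc hAc ⟨D, hDc, hX⟩ with h | h
    · obtain ⟨Y, hY, hb⟩ := h
      have : Y = C := inter_unique hkc (btw_inc_mid hb hB hA) hY hC hCc
      subst this
      exact absurd (btw_symm hb) H3
    · exact h
  obtain ⟨E, hEa, hE⟩ := hE
  obtain ⟨n, hXn, hCn⟩ := exists_line (G := G) (btw_ne hE)
  have hEn := btw_inc_mid hE hXn hCn
  have hnc : n ≠ c := by rintro rfl; exact hXc hXn
  have hEc : ¬ G.inc E c := fun h => btw_ne_right hE (inter_unique hnc hEn h hCn hCc)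
  have hAE : G.Opp c A E := by
    rcases opp_split hXc hAc hEc hF with h | h
    · obtain ⟨Y, hY, hb⟩ := h
      have : Y = C := inter_unique hnc (btw_inc_mid hb hXn hEn) hY hCn hCc
      subst this
      exact absurd hb (btw_not_right hE)
    · exact h
  obtain ⟨Y, hY, hb⟩ := hAE
  have : Y = D := inter_unique hac (btw_inc_mid hb hAa hEa) hY hDa hDc
  subst this
  have hEm : ¬ G.inc E m := fun h => btw_ne_right hb (inter_unique hma hDm hDa h hEa)
  have hnm : n ≠ m := by rintro rfl; exact hCm hCn
  rcases opp_split hAm hEm hCm ⟨Y, hDm, hb⟩ with h | h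
  · obtain ⟨Z, hZ, hb'⟩ := h
    have : Z = B := inter_unique hkm (btw_inc_mid hb' hA hC) hZ hB hBm
    subst this
    exact H1 hb'
  · obtain ⟨Z, hZ, hb'⟩ := h
    have : Z = X := inter_unique hnm (btw_inc_mid hb' hEn hCn) hZ hXn hXm
    subst this
    exact btw_not_left hE hb'

/-- Of the three points in which `g` would cut the sides, one lies between the other two. The side
carrying it then cuts the triangle formed by the other two points and the opposite vertex, and Pasch
makes it meet another side at a vertex, outside the segment in question. -/
theorem not_three_opp_of_not_collinear {A B C : Point} {g : Line} (h : ¬ G.Collinear A B C)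
    (hA : ¬ G.inc A g) (hB : ¬ G.inc B g) (hC : ¬ G.inc C g) (h1 : G.Opp g A B)
    (h2 : G.Opp g B C) (h3 : G.Opp g A C) : False := by
  have key : ∀ {A B C D E F : Point}, ¬ G.Collinear A B C → ¬ G.inc B g → G.inc D g →
      G.inc E g → G.inc F g → G.btw A D B → G.btw B F C → G.btw A E C → ¬ G.btw D E F := by
    intro A B C D E F h hB hD hE hF bD bF bE hb
    obtain ⟨c, hAc, hBc⟩ := exists_line (G := G) (btw_ne bD)
    obtain ⟨a, hBa, hCa⟩ := exists_line (G := G) (btw_ne bF)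
    obtain ⟨b, hAb, hCb⟩ := exists_line (G := G) (btw_ne bE)
    have hDc := btw_inc_mid bD hAc hBc
    have hFa := btw_inc_mid bF hBa hCa
    have hEb := btw_inc_mid bE hAb hCb
    have hbc : b ≠ c := by rintro rfl; exact h ⟨b, hAb, hBc, hCb⟩
    have hba : b ≠ a := by rintro rfl; exact h ⟨b, hAb, hBa, hCb⟩
    have hBb : ¬ G.inc B b := fun h' => h ⟨b, hAb, h', hCb⟩
    have hDb : ¬ G.inc D b := fun h' => btw_ne_left bD (inter_unique hbc hAb hAc h' hDc)
    have hFb : ¬ G.inc F b := fun h' => btw_ne_right bF (inter_unique hba h' hFa hCb hCa)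
    rcases opp_split hDb hFb hBb ⟨E, hEb, hb⟩ with h' | h'
    · obtain ⟨Z, hZ, hb'⟩ := h'
      have : Z = A := inter_unique hbc hZ (btw_inc_mid hb' hDc hBc) hAb hAc
      subst this
      exact btw_not_left bD hb'
    · obtain ⟨Z, hZ, hb'⟩ := h'
      have : Z = C := inter_unique hba hZ (btw_inc_mid hb' hFa hBa) hCb hCa
      subst this
      exact btw_not_left (btw_symm bF) hb'
  obtain ⟨D, hD, bD⟩ := h1
  obtain ⟨F, hF, bF⟩ := h2
  obtain ⟨E, hE, bE⟩ := h3
  have perm1 : ¬ G.Collinear B A C := fun ⟨m, x, y, z⟩ => h ⟨m, y, x, z⟩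
  have perm2 : ¬ G.Collinear A C B := fun ⟨m, x, y, z⟩ => h ⟨m, x, z, y⟩
  have eqs : ∀ {A B C X : Point}, ¬ G.Collinear A B C → G.btw A X B → G.btw B X C → False := by
    intro A B C X h hx hy
    obtain ⟨c, hAc, hBc⟩ := exists_line (G := G) (btw_ne hx)
    exact h ⟨c, hAc, hBc, btw_inc_right hy hBc (btw_inc_mid hx hAc hBc)⟩
  have hDF : D ≠ F := by rintro rfl; exact eqs h bD bF
  have hDE : D ≠ E := by rintro rfl; exact eqs perm1 (btw_symm bD) bE
  have hEF : E ≠ F := by rintro rfl; exact eqs perm2 bE (btw_symm bF)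
  rcases btw_trichotomy ⟨g, hD, hE, hF⟩ hDE hEF hDF with hb | hb | hb
  · exact key h hB hD hE hF bD bF bE hb
  · exact key perm2 hC hE hD hF bE (btw_symm bF) bD hb
  · exact key perm1 hA hD hF hE (btw_symm bD) bE bF hb

/-- With `opp_split` this shows that a line has just two sides. The collinear case again moves the
middle point `B` off the line. -/
theorem not_opp_of_opp_of_opp {A B C : Point} {g : Line}
    (hA : ¬ G.inc A g) (hB : ¬ G.inc B g) (hC : ¬ G.inc C g) (h1 : G.Opp g A B)
    (h2 : G.Opp g B C) : ¬ G.Opp g A C := by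
  intro h3
  by_cases h : G.Collinear A B C
  swap
  · exact not_three_opp_of_not_collinear h hA hB hC h1 h2 h3
  obtain ⟨k, hAk, hBk, hCk⟩ := h
  obtain ⟨P, hPk, hP, hBP⟩ := exists_same_side_not_inc hB hBk
  have hAC : A ≠ C := by obtain ⟨_, _, h⟩ := h3; exact btw_ne h
  have hAP : G.Opp g A P := (opp_split hA hB hP h1).resolve_right hBP
  have hCP : G.Opp g P C := ((opp_split hB hC hP h2).resolve_left hBP).symm
  exact not_three_opp_of_not_collinear
    (fun ⟨m, x, y, z⟩ => hPk (line_unique hAC x z hAk hCk ▸ y)) hA hP hC hAP hCP h3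

theorem ray_inc {O A X : Point} {g : Line} (hOA : A ≠ O) (h : X ∈ G.ray O A) (hO : G.inc O g)
    (hA : G.inc A g) : G.inc X g :=
  (collinear_iff hOA.symm hO hA).1 h.2.1

theorem mem_ray_self {O A : Point} (h : A ≠ O) : A ∈ G.ray O A := by
  obtain ⟨g, h1, h2⟩ := exists_line (G := G) h
  exact ⟨h, ⟨g, h2, h1, h1⟩, fun hb => btw_ne hb rfl⟩

/-- Betweenness of points on a line can be read off from any other line through the middle one. -/
theorem opp_iff_btw {O A B : Point} {g k : Line} (hOg : G.inc O g) (hOk : G.inc O k)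
    (hA : G.inc A k) (hB : G.inc B k) (hgk : g ≠ k) : G.Opp g A B ↔ G.btw A O B := by
  constructor
  · rintro ⟨Y, hY, hb⟩
    rwa [← inter_unique hgk hY (btw_inc_mid hb hA hB) hOg hOk]
  · exact fun h => ⟨O, hOg, h⟩

theorem exists_other_line (O : Point) (k : Line) (hO : G.inc O k) : ∃ g, G.inc O g ∧ g ≠ k := by
  obtain ⟨P, hP⟩ := exists_not_inc (G := G) k
  obtain ⟨g, h1, h2⟩ := exists_line (G := G) (ne_of_inc hO hP)
  exact ⟨g, h1, by rintro rfl; exact hP h2⟩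

theorem mem_ray_of_btw_btw {O A B C : Point} (h1 : G.btw A O B) (h2 : G.btw A O C) :
    C ∈ G.ray O B := by
  obtain ⟨k, hA, hO, hB⟩ := btw_collinear h1
  have hC := btw_inc_right h2 hA hO
  obtain ⟨g, hOg, hgk⟩ := exists_other_line O k hO
  have off : ∀ {X}, G.inc X k → X ≠ O → ¬ G.inc X g := fun h h' h'' =>
    h' (inter_unique hgk h'' h hOg hO)
  refine ⟨(btw_ne_right h2).symm, ⟨k, hO, hB, hC⟩, fun h => ?_⟩
  exact not_opp_of_opp_of_opp (off hB (btw_ne_right h1).symm) (off hA (btw_ne_left h1))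
    (off hC (btw_ne_right h2).symm) ((opp_iff_btw hOg hO hA hB hgk).2 h1).symm
    ((opp_iff_btw hOg hO hA hC hgk).2 h2) ((opp_iff_btw hOg hO hC hB hgk).2 h).symm

theorem btw_of_btw_of_mem_ray {O A B C : Point} (h1 : G.btw A O B) (h2 : C ∈ G.ray O B) :
    G.btw A O C := by
  obtain ⟨k, hA, hO, hB⟩ := btw_collinear h1
  have hC := ray_inc (btw_ne_right h1).symm h2 hO hB
  obtain ⟨g, hOg, hgk⟩ := exists_other_line O k hO
  have off : ∀ {X}, G.inc X k → X ≠ O → ¬ G.inc X g := fun h h' h'' =>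
    h' (inter_unique hgk h'' h hOg hO)
  have hOp := (opp_iff_btw hOg hO hA hB hgk).2 h1
  rcases opp_split (off hA (btw_ne_left h1)) (off hB (btw_ne_right h1).symm) (off hC h2.1) hOp
    with h | h
  · exact (opp_iff_btw hOg hO hA hC hgk).1 h
  · exact absurd (btw_symm ((opp_iff_btw hOg hO hB hC hgk).1 h)) h2.2.2

theorem mem_ray_symm {O A B : Point} (hA : A ≠ O) (h : B ∈ G.ray O A) : A ∈ G.ray O B := by
  obtain ⟨h1, ⟨k, x, y, z⟩, h3⟩ := h
  exact ⟨hA, ⟨k, x, z, y⟩, fun hb => h3 (btw_symm hb)⟩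

theorem mem_ray_trans {O A B C : Point} (h : B ∈ G.ray O A) (h2 : C ∈ G.ray O B) :
    C ∈ G.ray O A := by
  obtain ⟨k, x, y, z⟩ := h.2.1
  refine ⟨h2.1, ⟨k, x, y, ray_inc h.1 h2 x z⟩, fun hb => ?_⟩
  exact (mem_ray_symm h.1 h2).2.2 (btw_symm (btw_of_btw_of_mem_ray hb h))

theorem ray_eq {O A B : Point} (hA : A ≠ O) (h : B ∈ G.ray O A) : G.ray O B = G.ray O A :=
  Set.ext fun _ => ⟨fun h2 => mem_ray_trans h h2,
    fun h2 => mem_ray_trans (mem_ray_symm hA h) h2⟩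

/-- On a line through `O`, a point other than `O` is on a given ray or on the opposite one. -/
theorem mem_ray_or_btw {O A X : Point} {k : Line} (hO : G.inc O k) (hA : G.inc A k)
    (hX : G.inc X k) (hXO : X ≠ O) : X ∈ G.ray O A ∨ G.btw X O A := by
  by_cases h : G.btw X O A
  · exact Or.inr h
  · exact Or.inl ⟨hXO, ⟨k, hO, hA, hX⟩, h⟩

theorem btw_mem_ray {O A B : Point} (h : G.btw O A B) : B ∈ G.ray O A := by
  obtain ⟨k, x, y, z⟩ := btw_collinear h
  exact ⟨(btw_ne h).symm, ⟨k, x, y, z⟩, fun hb => btw_not_left h (btw_symm hb)⟩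

theorem btw_mem_ray' {O A B : Point} (h : G.btw O A B) : A ∈ G.ray O B :=
  mem_ray_symm (btw_ne_left h).symm (btw_mem_ray h)

/-- Points of a ray issuing from a line lie on one side of it. -/
theorem not_opp_of_mem_ray {O A X : Point} {g : Line} (hO : G.inc O g) (hA : ¬ G.inc A g)
    (h : X ∈ G.ray O A) : ¬ G.inc X g ∧ ¬ G.Opp g A X := by
  obtain ⟨h1, ⟨k, x, y, z⟩, h3⟩ := h
  have hgk : g ≠ k := by rintro rfl; exact hA y
  refine ⟨fun hX => h1 (inter_unique hgk hX z hO x), fun h => ?_⟩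
  exact h3 (btw_symm ((opp_iff_btw hO x y z hgk).1 h))

theorem mem_halfPlane {g : Line} {S X : Point} :
    X ∈ G.halfPlane g S ↔ ¬ G.inc X g ∧ ¬ G.Opp g S X := by
  simp [halfPlane, Opp]

theorem same_trans {g : Line} {A B C : Point} (hA : ¬ G.inc A g) (hB : ¬ G.inc B g)
    (hC : ¬ G.inc C g) (h1 : ¬ G.Opp g A B) (h2 : ¬ G.Opp g B C) : ¬ G.Opp g A C := by
  intro h
  rcases opp_split hA hC hB h with h | h
  · exact h1 h
  · exact h2 h.symm

theorem opp_of_opp_of_same {g : Line} {A B C : Point} (hA : ¬ G.inc A g) (hB : ¬ G.inc B g)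
    (hC : ¬ G.inc C g) (h1 : G.Opp g A B) (h2 : ¬ G.Opp g B C) : G.Opp g A C :=
  (opp_split hA hB hC h1).resolve_right h2

end Order

/-! ### Congruence: lengths, triangles, supplementary and vertical angles. -/

section Congruence

set_option linter.unusedSectionVars false

variable {Point Line : Type*} {G : PlaneGeometry Point Line} [HilbertPlane G]

theorem collinear_self (A B : Point) : G.Collinear A A B := by
  have key : ∀ {A B}, A ≠ B → G.Collinear A A B := fun h =>
    let ⟨g, h1, h2⟩ := exists_line (G := G) h; ⟨g, h1, h1, h2⟩
  by_cases h : A = B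
  · subst h
    obtain ⟨g⟩ := HilbertPlane.nonempty_line (G := G)
    obtain ⟨P, hP, -⟩ := exists_inc_ne (G := G) g A
    obtain ⟨k, h1, -, -⟩ := key hP.symm
    exact ⟨k, h1, h1, h1⟩
  · exact key h

theorem not_collinear_ne {A B C : Point} (h : ¬ G.Collinear A B C) : A ≠ B ∧ B ≠ C ∧ A ≠ C := by
  have h1 := collinear_self (G := G) A B
  have h2 := collinear_self (G := G) A C
  have h3 := collinear_self (G := G) B A
  grind [Collinear]

theorem not_collinear_swap {A B C : Point} (h : ¬ G.Collinear A B C) : ¬ G.Collinear B A C := by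
  grind [Collinear]

theorem not_collinear_reverse {A B C : Point} (h : ¬ G.Collinear A B C) : ¬ G.Collinear C B A := by
  grind [Collinear]

theorem not_collinear_replace {A O B P : Point} (h : ¬ G.Collinear A O B) (h1 : P ≠ O)
    (h2 : G.Collinear O A P) : ¬ G.Collinear P O B := by
  grind [Collinear, line_unique]

theorem not_collinear_ray {A O B P Q : Point} (h : ¬ G.Collinear A O B) (h1 : P ∈ G.ray O A)
    (h2 : Q ∈ G.ray O B) : ¬ G.Collinear P O Q :=
  not_collinear_reverse (not_collinear_replace (not_collinear_reverse
    (not_collinear_replace h h1.1 h1.2.1)) h2.1 h2.2.1)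

theorem exists_line_of_not_collinear {A B C : Point} (h : ¬ G.Collinear A B C) :
    ∃ g, G.inc A g ∧ G.inc B g ∧ ¬ G.inc C g := by
  obtain ⟨g, h1, h2⟩ := exists_line (G := G) (not_collinear_ne h).1
  exact ⟨g, h1, h2, fun h3 => h ⟨g, h1, h2, h3⟩⟩

theorem segCongr_refl {A B : Point} (h : A ≠ B) : G.segCongr s(A, B) s(A, B) := by
  obtain ⟨C, hC, hs⟩ := HilbertPlane.congruence.seg_transport A B A B h h (G := G)
  exact HilbertPlane.congruence.seg_trans A C A B A B hC.1.symm h h hs hs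

theorem segCongr_symm {A B C D : Point} (h : A ≠ B) (h' : C ≠ D)
    (hs : G.segCongr s(A, B) s(C, D)) : G.segCongr s(C, D) s(A, B) :=
  HilbertPlane.congruence.seg_trans C D C D A B h' h' h (segCongr_refl h') hs

theorem segCongr_trans {A B C D E F : Point} (h : A ≠ B) (h' : C ≠ D) (h'' : E ≠ F)
    (h1 : G.segCongr s(A, B) s(C, D)) (h2 : G.segCongr s(C, D) s(E, F)) :
    G.segCongr s(A, B) s(E, F) :=
  HilbertPlane.congruence.seg_trans C D A B E F h' h h'' h1 (segCongr_symm h' h'' h2)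

/-- The length of the possibly degenerate segment `AB`: its congruence class. -/
def len (G : PlaneGeometry Point Line) (A B : Point) : Set (Sym2 Point) :=
  {s | (A = B ∧ s.IsDiag) ∨ (A ≠ B ∧ ¬ s.IsDiag ∧ G.segCongr s s(A, B))}

theorem len_comm (A B : Point) : G.len A B = G.len B A := by
  unfold len; rw [Sym2.eq_swap]; simp only [eq_comm, ne_eq]

theorem mem_len {A B : Point} : s(A, B) ∈ G.len A B := by
  by_cases h : A = B
  · exact Or.inl ⟨h, by simpa using h⟩
  · exact Or.inr ⟨h, by simpa using h, segCongr_refl h⟩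

theorem len_eq_iff {A B C D : Point} (h : A ≠ B) (h' : C ≠ D) :
    G.len A B = G.len C D ↔ G.segCongr s(A, B) s(C, D) := by
  constructor
  · intro H
    have := mem_len (G := G) (A := A) (B := B)
    rw [H] at this
    rcases this with h1 | h1
    · exact absurd h1.1 h'
    · exact h1.2.2
  · intro H
    ext s
    induction s with | _ X Y =>
    simp only [len, Set.mem_ofPred_eq, h, h', false_and, false_or, Sym2.mk_isDiag_iff, ne_eq,
      not_false_iff, true_and]
    constructor
    · exact fun ⟨h1, h2⟩ => ⟨h1, segCongr_trans h1 h h' h2 H⟩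
    · exact fun ⟨h1, h2⟩ => ⟨h1, segCongr_trans h1 h' h h2 (segCongr_symm h h' H)⟩

theorem len_self (A B : Point) : G.len A A = G.len B B := by simp [len]

theorem eq_of_len {A B C : Point} (H : G.len A B = G.len C C) : A = B := by
  have := mem_len (G := G) (A := A) (B := B)
  rw [H] at this
  rcases this with h | h
  · simpa using h.2
  · exact absurd rfl h.1

theorem angle_comm (A O B : Point) : G.angle A O B = G.angle B O A := Sym2.eq_swap

theorem angle_eq {A O B P Q : Point} (hA : A ≠ O) (hB : B ≠ O) (h1 : P ∈ G.ray O A)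
    (h2 : Q ∈ G.ray O B) : G.angle P O Q = G.angle A O B := by
  rw [angle, angle, ray_eq hA h1, ray_eq hB h2]

theorem exists_len {A B O C : Point} (h : A ≠ B) (h' : C ≠ O) :
    ∃ D ∈ G.ray O C, G.len O D = G.len A B := by
  obtain ⟨D, hD, hs⟩ := HilbertPlane.congruence.seg_transport A B O C h h'.symm (G := G)
  exact ⟨D, hD, ((len_eq_iff h hD.1.symm).2 hs).symm⟩

theorem exists_len_btw {A B C O : Point} (h : A ≠ B) (h' : C ≠ O) :
    ∃ D, G.btw C O D ∧ G.len O D = G.len A B := by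
  obtain ⟨E, hE⟩ := btw_extend (G := G) h'
  obtain ⟨D, hD, hl⟩ := exists_len (G := G) h (btw_ne_right hE).symm
  exact ⟨D, btw_of_btw_of_mem_ray hE hD, hl⟩

theorem len_add {A B C A' B' C' : Point} (h : G.btw A B C) (h' : G.btw A' B' C')
    (h1 : G.len A B = G.len A' B') (h2 : G.len B C = G.len B' C') : G.len A C = G.len A' C' := by
  rw [len_eq_iff (btw_ne h) (btw_ne h')]
  exact HilbertPlane.congruence.seg_add A B C A' B' C' h h'
    ((len_eq_iff (btw_ne_left h) (btw_ne_left h')).1 h1)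
    ((len_eq_iff (btw_ne_right h) (btw_ne_right h')).1 h2)

theorem sas_angle {A B C A' B' C' : Point} (h : ¬ G.Collinear A B C) (h' : ¬ G.Collinear A' B' C')
    (h1 : G.len A B = G.len A' B') (h2 : G.len A C = G.len A' C')
    (ha : G.angCongr (G.angle B A C) (G.angle B' A' C')) :
    G.angCongr (G.angle A B C) (G.angle A' B' C') := by
  have n := not_collinear_ne h
  have n' := not_collinear_ne h'
  exact HilbertPlane.congruence.sas A B C A' B' C' h h' ((len_eq_iff n.1 n'.1).1 h1)
    ((len_eq_iff n.2.2 n'.2.2).1 h2) ha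

theorem angCongr_refl {A O B : Point} (h : ¬ G.Collinear A O B) :
    G.angCongr (G.angle A O B) (G.angle A O B) :=
  HilbertPlane.congruence.ang_refl A O B h

theorem exists_angle {A O B O' A' S : Point} {g : Line} (h : ¬ G.Collinear A O B) (hA' : A' ≠ O')
    (hO : G.inc O' g) (hA : G.inc A' g) (hS : ¬ G.inc S g) :
    ∃ B', ¬ G.inc B' g ∧ ¬ G.Opp g S B' ∧ G.angCongr (G.angle A O B) (G.angle A' O' B') := by
  obtain ⟨r, ⟨⟨B', hB', rfl⟩, ha⟩, -⟩ :=
    HilbertPlane.congruence.ang_transport A O B O' A' S g h hA'.symm hO hA hS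
  rw [mem_halfPlane] at hB'
  exact ⟨B', hB'.1, hB'.2, ha⟩

/-- Symmetry and transitivity of angle congruence are not among the axioms and are not derived, so
both congruences have to start from the same angle `AOB`. This shapes many later arguments. -/
theorem angle_unique {A O B O' A' P Q : Point} {g : Line} (h : ¬ G.Collinear A O B) (hA' : A' ≠ O')
    (hO : G.inc O' g) (hA : G.inc A' g) (hP : ¬ G.inc P g) (hQ : ¬ G.inc Q g)
    (hPQ : ¬ G.Opp g P Q) (h1 : G.angCongr (G.angle A O B) (G.angle A' O' P))
    (h2 : G.angCongr (G.angle A O B) (G.angle A' O' Q)) : Q ∈ G.ray O' P := by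
  obtain ⟨r, -, hr⟩ :=
    HilbertPlane.congruence.ang_transport A O B O' A' P g h hA'.symm hO hA hP
  have e1 := hr (G.ray O' P) ⟨⟨P, mem_halfPlane.2 ⟨hP, not_opp_self⟩, rfl⟩, h1⟩
  have e2 := hr (G.ray O' Q) ⟨⟨Q, mem_halfPlane.2 ⟨hQ, hPQ⟩, rfl⟩, h2⟩
  rw [e1, ← e2]
  exact mem_ray_self (ne_of_inc hO hQ).symm

/-- Uniqueness of segment transport comes from that of angle transport: for `D` off the line,
triangles `ODP` and `ODQ` have congruent angles at `D`, so `Q` lies on the ray `DP` as well as on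
the line `OP`. -/
theorem eq_of_len_of_mem_ray {O C P Q : Point} (hC : C ≠ O) (hP : P ∈ G.ray O C)
    (hQ : Q ∈ G.ray O C) (h : G.len O P = G.len O Q) : P = Q := by
  obtain ⟨k, hCk, hOk⟩ := exists_line (G := G) hC
  obtain ⟨D, hD⟩ := exists_not_inc (G := G) k
  have hPk := ray_inc hC hP hOk hCk
  have hQk := ray_inc hC hQ hOk hCk
  obtain ⟨m, hOm, hDm⟩ := exists_line (G := G) (ne_of_inc hOk hD)
  have hkm : k ≠ m := by rintro rfl; exact hD hDm
  have off : ∀ {X}, G.inc X k → X ≠ O → ¬ G.inc X m := fun h h' h'' =>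
    h' (inter_unique hkm h h'' hOk hOm)
  have hD' := (ne_of_inc hOk hD)
  have nP : ¬ G.Collinear O D P := not_collinear hD' hOm hDm (off hPk hP.1)
  have nQ : ¬ G.Collinear O D Q := not_collinear hD' hOm hDm (off hQk hQ.1)
  have a1 : G.angCongr (G.angle O D P) (G.angle O D Q) := by
    refine sas_angle nP nQ rfl h ?_
    rw [angle_eq hD'.symm hP.1 (mem_ray_self hD'.symm)
      (mem_ray_trans (mem_ray_symm hC hP) hQ)]
    exact angCongr_refl (not_collinear_swap nP)
  have hPQ : Q ∈ G.ray O P := mem_ray_trans (mem_ray_symm hC hP) hQ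
  have hop := not_opp_of_mem_ray hOm (off hPk hP.1) hPQ
  have := angle_unique nP hD' hDm hOm (off hPk hP.1) hop.1 hop.2 (angCongr_refl nP) a1
  by_contra hne
  obtain ⟨n, hDn, hPn, hQn⟩ := this.2.1
  exact hD (line_unique hne hPn hQn hPk hQk ▸ hDn)

/-- The congruence theorem for two sides and the included angle. -/
theorem sas {A B C A' B' C' : Point} (h : ¬ G.Collinear A B C) (h' : ¬ G.Collinear A' B' C')
    (h1 : G.len A B = G.len A' B') (h2 : G.len A C = G.len A' C')
    (ha : G.angCongr (G.angle B A C) (G.angle B' A' C')) :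
    G.len B C = G.len B' C' ∧ G.angCongr (G.angle A B C) (G.angle A' B' C') ∧
      G.angCongr (G.angle A C B) (G.angle A' C' B') := by
  have b := sas_angle h h' h1 h2 ha
  have nr : ∀ {A B C : Point}, ¬ G.Collinear A B C → ¬ G.Collinear A C B := by grind [Collinear]
  refine ⟨?_, b, sas_angle (nr h) (nr h') h2 h1 (by rwa [angle_comm C, angle_comm C'])⟩
  have n := not_collinear_ne h
  have n' := not_collinear_ne h'
  -- `D` is where `C'` ought to be. The angle `B'A'D` matches `BAC`, so `D` lies on the ray `A'C'`
  -- as well as on `B'C'`, whence `D = C'`.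
  obtain ⟨D, hD, hl⟩ := exists_len (G := G) n.2.1 n'.2.1.symm
  obtain ⟨g, hA, hB, hC⟩ := exists_line_of_not_collinear h'
  have hop := not_opp_of_mem_ray hB hC hD
  have hD' : ¬ G.Collinear B' A' D := not_collinear n'.1.symm hB hA hop.1
  have b' : G.angCongr (G.angle B A C) (G.angle B' A' D) := by
    refine sas_angle (not_collinear_swap h) hD' (by rw [len_comm, h1, len_comm]) hl.symm ?_
    rw [angle_eq n'.1 n'.2.1.symm (mem_ray_self n'.1) hD]
    exact b
  have := angle_unique (not_collinear_swap h) n'.1.symm hA hB hC hop.1 hop.2 ha b'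
  have hDC : D = C' := by
    by_contra hne
    obtain ⟨n, x, y, z⟩ := this.2.1
    obtain ⟨k, x', y', z'⟩ := hD.2.1
    have := line_unique hne z y z' y'
    subst this
    exact h' ⟨n, x, x', y⟩
  rw [← hl, hDC]

theorem isosceles {A B C : Point} (h : ¬ G.Collinear A B C) (h1 : G.len A B = G.len A C) :
    G.angCongr (G.angle A B C) (G.angle A C B) := by
  have nr : ¬ G.Collinear A C B := by grind [Collinear]
  refine sas_angle h nr h1 h1.symm ?_
  rw [angle_comm C]
  exact angCongr_refl (not_collinear_swap h)

theorem not_collinear_opposite {A O B C : Point} (hb : G.btw A O C) (h : ¬ G.Collinear A O B) :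
    ¬ G.Collinear C O B := by
  have := btw_collinear hb
  exact not_collinear_replace h (btw_ne_right hb).symm (by grind [Collinear])

theorem not_collinear_extend {A O B C : Point} (hb : G.btw A O C) (h : ¬ G.Collinear A O B) :
    ¬ G.Collinear A C B := by
  have := btw_collinear hb
  have := btw_ne hb
  grind [Collinear, line_unique]

/-- Supplements of congruent angles are congruent. -/
theorem supplement {A O B C A' O' B' C' : Point} (h : ¬ G.Collinear A O B)
    (h' : ¬ G.Collinear A' O' B') (ha : G.angCongr (G.angle A O B) (G.angle A' O' B'))
    (hC : G.btw A O C) (hC' : G.btw A' O' C') :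
    G.angCongr (G.angle C O B) (G.angle C' O' B') := by
  have n := not_collinear_ne h
  have n' := not_collinear_ne h'
  -- `P`, `Q`, `R` copy the distances of `A`, `B`, `C` from `O` onto the primed rays. Three
  -- congruent pairs of triangles follow: with vertices `O, A, B`, then `A, B, C`, then `C, O, B`.
  obtain ⟨P, hP, lP⟩ := exists_len (G := G) n.1.symm n'.1
  obtain ⟨Q, hQ, lQ⟩ := exists_len (G := G) n.2.1 n'.2.1.symm
  obtain ⟨R, hR, lR⟩ := exists_len (G := G) (btw_ne_right hC) (btw_ne_right hC').symm
  have hPR : G.btw P O' R :=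
    btw_symm (btw_of_btw_of_mem_ray (btw_symm (btw_of_btw_of_mem_ray hC' hR)) hP)
  rw [← angle_eq n'.1 n'.2.1.symm hP hQ] at ha
  rw [← angle_eq (btw_ne_right hC').symm n'.2.1.symm hR hQ]
  have hn : ¬ G.Collinear P O' Q := not_collinear_ray h' hP hQ
  have s1 := sas (not_collinear_swap h) (not_collinear_swap hn) lP.symm lQ.symm ha
  have lPR : G.len A C = G.len P R := len_add hC hPR (by grind [len_comm]) lR.symm
  have e := not_collinear_extend hC h
  have e' := not_collinear_extend hPR hn
  have s2 := sas (A := A) (B := B) (C := C) (A' := P) (B' := Q) (C' := R) (by grind [Collinear])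
    (by grind [Collinear]) s1.1 lPR (by
      rw [angle_eq (not_collinear_ne h).2.2.symm (btw_ne_left hC).symm
        (mem_ray_self (not_collinear_ne h).2.2.symm) (btw_mem_ray hC),
        angle_eq (not_collinear_ne hn).2.2.symm (btw_ne_left hPR).symm
        (mem_ray_self (not_collinear_ne hn).2.2.symm) (btw_mem_ray hPR),
        angle_comm B, angle_comm Q]
      exact s1.2.1)
  refine (sas_angle (A := C) (A' := R) (not_collinear_opposite hC h)
    (not_collinear_opposite hPR hn) (by grind [len_comm]) (by grind [len_comm]) ?_)
  rw [← angle_eq (btw_ne_right hC) (not_collinear_ne e).2.1.symm (btw_mem_ray (btw_symm hC))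
    (mem_ray_self (not_collinear_ne e).2.1.symm),
    ← angle_eq (btw_ne_right hPR) (not_collinear_ne e').2.1.symm (btw_mem_ray (btw_symm hPR))
    (mem_ray_self (not_collinear_ne e').2.1.symm)]
  exact s2.2.2

/-- Vertical angles are congruent. -/
theorem vertical {A O B C D : Point} (h : ¬ G.Collinear A O B) (hC : G.btw A O C)
    (hD : G.btw B O D) : G.angCongr (G.angle C O B) (G.angle D O A) := by
  refine supplement h (not_collinear_reverse h) ?_ hC hD
  rw [angle_comm B]
  exact angCongr_refl h

/-- Subtraction of segments. -/
theorem len_sub {O B C O' B' C' : Point} (h : G.btw O B C) (hB' : B' ≠ O')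
    (h' : C' ∈ G.ray O' B')
    (h1 : G.len O B = G.len O' B') (h2 : G.len O C = G.len O' C') :
    G.btw O' B' C' ∧ G.len B C = G.len B' C' := by
  obtain ⟨D, hD, hl⟩ := exists_len_btw (G := G) (btw_ne_right h) hB'.symm
  have := len_add h hD h1 hl.symm
  have hDC : D = C' := eq_of_len_of_mem_ray hB' (btw_mem_ray hD) h' (this.symm.trans h2)
  subst hDC
  exact ⟨hD, hl.symm⟩

end Congruence

/-! ### Mirror images in a line. -/

section Mirror

set_option linter.unusedSectionVars false

variable {Point Line : Type*} {G : PlaneGeometry Point Line} [HilbertPlane G]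

/-- `P` and `P'` are mirror images in the line `g`. -/
structure Mir (G : PlaneGeometry Point Line) (g : Line) (P P' : Point) : Prop where
  left : ¬ G.inc P g
  right : ¬ G.inc P' g
  opp : G.Opp g P P'
  len : ∀ X, G.inc X g → G.len X P = G.len X P'

theorem Mir.symm {g : Line} {P P' : Point} (h : G.Mir g P P') : G.Mir g P' P :=
  ⟨h.right, h.left, h.opp.symm, fun X hX => (h.len X hX).symm⟩

/-- One point of the mirror and the angle there suffice. Points on the ray `AB` are handled by SAS
at `A`; points beyond `A` lie on the ray `BA` and are handled by SAS at `B`. -/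
theorem mir_of_angle {g : Line} {A B P P' : Point} (hAB : B ≠ A) (hA : G.inc A g) (hB : G.inc B g)
    (hP : ¬ G.inc P g) (hP' : ¬ G.inc P' g) (ho : G.Opp g P P') (hl : G.len A P = G.len A P')
    (ha : G.angCongr (G.angle B A P) (G.angle B A P')) : G.Mir g P P' := by
  refine ⟨hP, hP', ho, fun X hX => ?_⟩
  by_cases hXA : X = A
  · rwa [hXA]
  have hPA := (ne_of_inc hA hP).symm
  have hPA' := (ne_of_inc hA hP').symm
  rcases mem_ray_or_btw hA hB hX hXA with h | h
  · refine (sas (not_collinear (Ne.symm hXA) hA hX hP) (not_collinear (Ne.symm hXA) hA hX hP')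
      rfl hl ?_).1
    rwa [angle_eq hAB hPA h (mem_ray_self hPA), angle_eq hAB hPA' h (mem_ray_self hPA')]
  · have s := sas (not_collinear hAB.symm hA hB hP) (not_collinear hAB.symm hA hB hP') rfl hl ha
    have hPB := (ne_of_inc hB hP).symm
    have hPB' := (ne_of_inc hB hP').symm
    have hXB := btw_ne h
    refine (sas (not_collinear hXB.symm hB hX hP) (not_collinear hXB.symm hB hX hP')
      rfl s.1 ?_).1
    rw [angle_eq hAB.symm hPB (btw_mem_ray (btw_symm h)) (mem_ray_self hPB),
      angle_eq hAB.symm hPB' (btw_mem_ray (btw_symm h)) (mem_ray_self hPB')]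
    exact s.2.1

theorem exists_mir {g : Line} {P : Point} (hP : ¬ G.inc P g) : ∃ P', G.Mir g P P' := by
  obtain ⟨A, B, hAB, hA, hB⟩ := HilbertPlane.incidence (G := G).two_points g
  have hPA := (ne_of_inc hA hP).symm
  obtain ⟨S, hS⟩ := btw_extend (G := G) hPA
  have hSg : ¬ G.inc S g := fun h => hP (btw_inc_left hS hA h)
  obtain ⟨T, hT, hST, ha⟩ := exists_angle (not_collinear hAB.symm hB hA hP) hAB.symm hA hB hSg
  have hTA := (ne_of_inc hA hT).symm
  obtain ⟨P', hP', hl⟩ := exists_len (G := G) hPA.symm hTA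
  obtain ⟨h1, h2⟩ := not_opp_of_mem_ray hA hT hP'
  refine ⟨P', mir_of_angle hAB.symm hA hB hP h1 ?_ hl.symm ?_⟩
  · exact opp_of_opp_of_same hP hT h1 (opp_of_opp_of_same hP hSg hT ⟨A, hA, hS⟩ hST) h2
  · rwa [angle_eq hAB.symm hTA (mem_ray_self hAB.symm) hP']

theorem Mir.not_inc {g m : Line} {P P' F Y : Point} (h : G.Mir g P P') (hF : G.inc F g)
    (hb : G.btw P F P') (hY : G.inc Y g) (hYF : Y ≠ F) (hP : G.inc P m) (hP' : G.inc P' m) :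
    ¬ G.inc Y m := fun hYm =>
  h.left (line_unique hYF hYm (btw_inc_mid hb hP hP') hY hF ▸ hP)

theorem Mir.not_collinear {g : Line} {P P' F Y : Point} (h : G.Mir g P P') (hF : G.inc F g)
    (hb : G.btw P F P') (hY : G.inc Y g) (hYF : Y ≠ F) : ¬ G.Collinear Y P P' :=
  fun ⟨_, x, y, z⟩ => h.not_inc hF hb hY hYF y z x

/-- The right angle at the foot, obtained from the base angles of the isosceles triangle `YPP'`. -/
theorem Mir.foot_angle {g : Line} {P P' F Y : Point} (h : G.Mir g P P') (hF : G.inc F g)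
    (hb : G.btw P F P') (hY : G.inc Y g) (hYF : Y ≠ F) :
    G.angCongr (G.angle Y F P) (G.angle Y F P') := by
  have n := h.not_collinear hF hb hY hYF
  have i := isosceles n (h.len Y hY)
  have n1 : ¬ G.Collinear P F Y := not_collinear_reverse (PlaneGeometry.not_collinear hYF hY hF h.left)
  have n2 : ¬ G.Collinear P' F Y :=
    not_collinear_reverse (PlaneGeometry.not_collinear hYF hY hF h.right)
  have e1 := (ne_of_inc hY h.left)
  have e2 := (ne_of_inc hY h.right)
  rw [← angle_eq e1 (btw_ne hb).symm (mem_ray_self e1) (btw_mem_ray' hb),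
    ← angle_eq e2 (btw_ne hb) (mem_ray_self e2) (btw_mem_ray' (btw_symm hb)),
    angle_comm, angle_comm Y P'] at i
  have := h.len F hF
  have := h.len Y hY
  have := sas_angle n1 n2 (by grind [len_comm]) (by grind [len_comm]) i
  rwa [angle_comm, angle_comm Y]

theorem Mir.exists_angle {g : Line} {P P' Y : Point} (h : G.Mir g P P') (hY : G.inc Y g) :
    ∃ Z, Z ≠ Y ∧ G.inc Z g ∧ G.angCongr (G.angle Z Y P) (G.angle Z Y P') := by
  obtain ⟨F, hF, hb⟩ := h.opp
  by_cases hYF : Y = F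
  · subst hYF
    obtain ⟨Z, hZ, hZg⟩ := exists_inc_ne (G := G) g Y
    exact ⟨Z, hZ, hZg, h.foot_angle hY hb hZg hZ⟩
  · refine ⟨F, Ne.symm hYF, hF, ?_⟩
    exact sas_angle (PlaneGeometry.not_collinear (Ne.symm hYF) hF hY h.left)
      (PlaneGeometry.not_collinear (Ne.symm hYF) hF hY h.right) rfl (h.len F hF)
      (h.foot_angle hF hb hY hYF)

/-- Let `F`, `E` be the feet of the two images. If they differ, the angle `EFP` is congruent to
`EFP₁` by the right angle at `F` and to `EFP₂` by SAS at `E`, so both images lie on one ray from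
`F`, at the same distance. -/
theorem Mir.unique {g : Line} {P P₁ P₂ : Point} (h1 : G.Mir g P P₁) (h2 : G.Mir g P P₂) :
    P₁ = P₂ := by
  obtain ⟨F, hF, bF⟩ := h1.opp
  obtain ⟨E, hE, bE⟩ := h2.opp
  have l1 := h1.len F hF
  have l2 := h2.len F hF
  have hray : P₂ ∈ G.ray F P₁ := by
    by_cases hFE : F = E
    · subst hFE
      exact mem_ray_of_btw_btw bF bE
    have n1 := PlaneGeometry.not_collinear (Ne.symm hFE) hE hF h1.left
    have n2 := PlaneGeometry.not_collinear (Ne.symm hFE) hE hF h2.right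
    have a1 := h1.foot_angle hF bF hE (Ne.symm hFE)
    have a2 := sas_angle n1 n2 rfl (h2.len E hE) (by
      have := h2.foot_angle hE bE hF hFE
      exact this)
    exact angle_unique n1 (Ne.symm hFE) hF hE h1.right h2.right
      (not_opp_of_opp_of_opp h1.right h1.left h2.right h1.opp.symm h2.opp) a1 a2
  exact eq_of_len_of_mem_ray (btw_ne_right bF).symm (mem_ray_self (btw_ne_right bF).symm) hray
    (l1.symm.trans l2)

/-- Reflection preserves the order of points on a line meeting the mirror. -/
theorem Mir.btw {g : Line} {P P' Q Q' Y : Point} (h : G.Mir g P P') (h' : G.Mir g Q Q')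
    (hY : G.inc Y g) (hb : G.btw P Y Q) : G.btw P' Y Q' := by
  obtain ⟨Z, hZ, hZg, ha⟩ := h.exists_angle hY
  have hP'Y := (ne_of_inc hY h.right).symm
  -- `R` continues `P'Y` by the length of `YQ`. Supplements of the mirrored angles at `Y` make it an
  -- image of `Q`, so it equals `Q'`.
  obtain ⟨R, hR, hl⟩ := exists_len_btw (G := G) (btw_ne_right hb) hP'Y
  have hRg : ¬ G.inc R g := fun hh => h.right (btw_inc_left hR hY hh)
  have n1 := not_collinear_reverse (PlaneGeometry.not_collinear hZ hZg hY h.left)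
  have n2 := not_collinear_reverse (PlaneGeometry.not_collinear hZ hZg hY h.right)
  rw [angle_comm, angle_comm Z] at ha
  have s := supplement n1 n2 ha hb hR
  rw [angle_comm, angle_comm R] at s
  have oPQ : G.Opp g P Q := ⟨Y, hY, hb⟩
  have oPR : G.Opp g P' R := ⟨Y, hY, hR⟩
  have oQR : G.Opp g Q R := (opp_of_opp_of_same hRg h.right h'.left oPR.symm
    (not_opp_of_opp_of_opp h.right h.left h'.left h.opp.symm oPQ)).symm
  have m : G.Mir g Q R := mir_of_angle hZ hY hZg h'.left hRg oQR hl.symm s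
  rwa [h'.unique m]

theorem Mir.ne {g : Line} {P Q : Point} (h : G.Mir g P Q) : P ≠ Q :=
  let ⟨_, _, hb⟩ := h.opp; btw_ne hb

/-- `AQ` crosses the mirror at `Y`. The triangles `APQ` and `YPQ` are both isosceles over `PQ` and
share the angle at `Q`, so `A` and `Y` lie on one ray from `P`, which is absurd. When `A` is on `PQ`
lengths are compared directly. -/
theorem Mir.false_of_len {g : Line} {P Q A : Point} (h : G.Mir g P Q) (hA : ¬ G.inc A g)
    (hs : ¬ G.Opp g P A) (hl : G.len A P = G.len A Q) : False := by
  have hAP : P ≠ A := by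
    rintro rfl
    exact h.ne (eq_of_len hl.symm)
  obtain ⟨Y, hY, hb⟩ := opp_of_opp_of_same h.right h.left hA h.opp.symm hs
  by_cases hc : G.Collinear P Q A
  · obtain ⟨F, hF, bF⟩ := h.opp
    obtain ⟨k, hP, hQ, hAk⟩ := hc
    have hgk : g ≠ k := by rintro rfl; exact h.left hP
    obtain rfl := inter_unique hgk hF (btw_inc_mid bF hP hQ) hY (btw_inc_mid hb hQ hAk)
    have hFk := btw_inc_mid bF hP hQ
    have hr : P ∈ G.ray F A := mem_ray_of_btw_btw hb (btw_symm bF)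
    rcases btw_trichotomy ⟨k, hFk, hAk, hP⟩ (btw_ne_right hb) hAP.symm (btw_ne_left bF).symm
      with h1 | h1 | h1
    · obtain ⟨B, hB, lB⟩ := exists_len (G := G) (btw_ne_right hb) (btw_ne_right bF).symm
      obtain ⟨h2, h3⟩ := len_sub h1 hB.1 (mem_ray_symm (btw_ne_right bF).symm hB) lB.symm
        (h.len F hF)
      have : B = A := eq_of_len_of_mem_ray (btw_ne_left hb).symm (btw_mem_ray' (btw_symm h2))
        (btw_mem_ray hb) (by grind [len_comm])
      subst this
      exact hB.2.2 (btw_symm hb)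
    · exact hr.2.2 (btw_symm h1)
    · refine h.ne (eq_of_len_of_mem_ray hAP (mem_ray_self hAP) ?_ hl)
      exact mem_ray_trans (btw_mem_ray (btw_symm h1)) (btw_mem_ray (btw_symm hb))
  · obtain ⟨k, hP, hQ, hAk⟩ := exists_line_of_not_collinear hc
    have hr : Y ∈ G.ray Q A := btw_mem_ray' hb
    obtain ⟨hYk, hop⟩ := not_opp_of_mem_ray hQ hAk hr
    have n1 : ¬ G.Collinear A Q P := by grind [Collinear]
    have n2 : ¬ G.Collinear Y Q P := by
      have := PlaneGeometry.not_collinear h.ne hP hQ hYk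
      grind [Collinear]
    have a1 := isosceles n1 hl.symm
    have a2 := isosceles n2 (h.len Y hY).symm
    have hAQ := (ne_of_inc hQ hAk).symm
    rw [angle_eq hAQ h.ne hr (mem_ray_self h.ne), angle_comm Y] at a2
    rw [angle_comm A P] at a1
    have := angle_unique n1 h.ne.symm hP hQ hAk hYk hop a1 a2
    obtain ⟨m, hPm, hAm, hYm⟩ := this.2.1
    exact hc ⟨m, hPm, btw_inc_left hb hYm hAm, hAm⟩

/-- The mirror of `P` and `Q` contains every point equidistant from `P` and `Q`. -/
theorem Mir.inc_of_len {g : Line} {P Q A : Point} (h : G.Mir g P Q)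
    (hl : G.len A P = G.len A Q) : G.inc A g := by
  by_contra hA
  by_cases hs : G.Opp g P A
  · exact h.symm.false_of_len hA (not_opp_of_opp_of_opp h.right h.left hA h.opp.symm hs) hl.symm
  · exact h.false_of_len hA hs hl

/-- Points on opposite sides: add the two pieces cut off by `g`. Points on the same side: `PQ'` and
`P'Q` cross on `g`, and SAS applies to the vertical angles there. -/
theorem Mir.len_eq {g : Line} {P P' Q Q' : Point} (h : G.Mir g P P') (h' : G.Mir g Q Q') :
    G.len P Q = G.len P' Q' := by
  by_cases hPQ : P = Q
  · subst hPQ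
    rw [h.unique h', len_self]
  by_cases ho : G.Opp g P Q
  · obtain ⟨Y, hY, hb⟩ := ho
    have := h.len Y hY
    have := h'.len Y hY
    exact len_add hb (h.btw h' hY hb) (by grind [len_comm]) (by grind [len_comm])
  obtain ⟨Y, hY, hb⟩ := opp_of_opp_of_same h'.right h'.left h.left h'.opp.symm
    (fun o => ho o.symm)
  have hb' := h'.symm.btw h hY hb
  by_cases hc : G.Collinear P Y Q
  · have key : ∀ {P P' Q Q'}, G.Mir g P P' → G.Mir g Q Q' → G.btw Y P Q → G.btw Q Y P' →
        G.btw Q' Y P → G.len P Q = G.len P' Q' := by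
      intro P P' Q Q' h h' h1 hb' hb
      have hP := btw_symm (btw_of_btw_of_mem_ray (btw_symm hb') (btw_mem_ray' h1))
      exact (len_sub h1 (btw_ne_right hP).symm (mem_ray_of_btw_btw hP (btw_symm hb))
        (h.len Y hY) (h'.len Y hY)).2
    rcases btw_trichotomy hc (btw_ne_right hb).symm (btw_ne_left hb').symm hPQ with h1 | h1 | h1
    · exact absurd ⟨Y, hY, h1⟩ ho
    · exact key h h' h1 hb' hb
    · rw [len_comm, len_comm P']
      exact key h' h (btw_symm h1) (btw_symm hb) (btw_symm hb')
  · have n1 := not_collinear_opposite (btw_symm hb) hc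
    have n2 := not_collinear_opposite hb' (not_collinear_reverse n1)
    exact (sas (not_collinear_swap hc) (not_collinear_swap n2) (h.len Y hY) (h'.len Y hY)
      (vertical n1 hb hb')).1

end Mirror

/-! ### Existence of perpendicular bisectors, without parallels. -/

section Midpoint

set_option linter.unusedSectionVars false

variable {Point Line : Type*} {G : PlaneGeometry Point Line} [HilbertPlane G]

theorem mir_of_isosceles {k : Line} {B F B' T : Point} (hb : G.btw B F B')
    (hF : G.len F B = G.len F B') (hT : G.len T B = G.len T B') (hn : ¬ G.Collinear B B' T)
    (hFk : G.inc F k) (hTk : G.inc T k) : G.Mir k B B' := by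
  have c := btw_collinear hb
  have b1 := btw_ne_left hb
  have b2 := btw_ne_right hb
  have b3 := btw_ne hb
  have hTF : T ≠ F := by
    rintro rfl
    grind [Collinear]
  have hB : ¬ G.inc B k := by grind [Collinear, line_unique]
  have hB' : ¬ G.inc B' k := by grind [Collinear, line_unique]
  have n1 := not_collinear hTF.symm hFk hTk hB
  have n2 := not_collinear hTF.symm hFk hTk hB'
  have i := isosceles (A := T) (B := B) (C := B') (by grind [Collinear]) hT
  have e1 := (ne_of_inc hTk hB)
  have e2 := (ne_of_inc hTk hB')
  rw [angle_comm, angle_comm T, ← angle_eq b3.symm e1 (btw_mem_ray' hb) (mem_ray_self e1),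
    ← angle_eq b3 e2 (btw_mem_ray' (btw_symm hb)) (mem_ray_self e2)] at i
  have s := sas_angle (A := B) (B := F) (C := T) (A' := B') (B' := F) (C' := T)
    (by grind [Collinear]) (by grind [Collinear]) (by grind [len_comm]) (by grind [len_comm]) i
  rw [angle_comm, angle_comm B'] at s
  exact mir_of_angle hTF hFk hTk hB hB' ⟨F, hFk, hb⟩ hF s

/-- Transport of a right angle. -/
theorem transport_right {n : Line} {A F A' S B O B' U : Point} (hS : ¬ G.Collinear A F S)
    (hA : G.btw A F A') (lA : G.len F A = G.len F A') (lS : G.len S A = G.len S A')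
    (hB : G.btw B O B') (lB : G.len O B = G.len O B') (lAB : G.len O B = G.len F A)
    (hBn : G.inc B n) (hOn : G.inc O n) (hU : ¬ G.inc U n) :
    ∃ T, ¬ G.inc T n ∧ ¬ G.Opp n U T ∧ G.len O T = G.len F S ∧ G.len T B = G.len T B' ∧
      G.angCongr (G.angle A F S) (G.angle B O T) := by
  obtain ⟨V, hV, hUV, ha⟩ := exists_angle hS (btw_ne_left hB) hOn hBn hU
  have hVO := (ne_of_inc hOn hV).symm
  obtain ⟨T, hT, lT⟩ := exists_len (G := G) (not_collinear_ne hS).2.1 hVO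
  obtain ⟨h1, h2⟩ := not_opp_of_mem_ray hOn hV hT
  rw [← angle_eq (btw_ne_left hB) hVO (mem_ray_self (btw_ne_left hB)) hT] at ha
  have nT : ¬ G.Collinear B O T := not_collinear (btw_ne_left hB) hBn hOn h1
  have s1 := sas (not_collinear_swap hS) (not_collinear_swap nT) lAB.symm lT.symm ha
  have s2 := sas (not_collinear_swap (not_collinear_opposite hA hS))
    (not_collinear_swap (not_collinear_opposite hB nT)) (by grind) lT.symm
    (supplement hS nT ha hA hB)
  exact ⟨T, h1, same_trans hU hV h1 hUV h2, lT, by grind [len_comm], ha⟩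

/-- A right angle exists at the foot of the perpendicular from `U` to `n`; it is carried to `O`. -/
theorem exists_right {n : Line} {B O B' U : Point} (hB : G.btw B O B')
    (lB : G.len O B = G.len O B') (hBn : G.inc B n) (hOn : G.inc O n) (hU : ¬ G.inc U n) :
    ∃ T, ¬ G.inc T n ∧ ¬ G.Opp n U T ∧ G.len T B = G.len T B' := by
  obtain ⟨U', m⟩ := exists_mir (G := G) hU
  obtain ⟨F, hF, hb⟩ := m.opp
  obtain ⟨C, hC, hCn⟩ := exists_inc_ne (G := G) n F
  obtain ⟨A, hA, lA⟩ := exists_len (G := G) (btw_ne_left hB).symm hC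
  have hAn := ray_inc hC hA hF hCn
  obtain ⟨A', hA', lA'⟩ := exists_len_btw (G := G) (btw_ne_left hB).symm hA.1
  have n1 : ¬ G.Collinear A F U := not_collinear hA.1 hAn hF hU
  have n2 : ¬ G.Collinear A F U' := not_collinear hA.1 hAn hF m.right
  have a := m.foot_angle hF hb hAn hA.1
  rw [angle_comm A F U'] at a
  have a2 := supplement n1 (not_collinear_reverse n2) a hA' (btw_symm hb)
  rw [angle_comm U] at a2
  have s := sas (not_collinear_swap (not_collinear_opposite hA' n1)) (not_collinear_swap n1)
    (by grind) rfl a2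
  obtain ⟨T, h1, h2, -, h3, -⟩ := transport_right n1 hA' (by grind) (by grind [len_comm]) hB lB
    lA.symm hBn hOn hU
  exact ⟨T, h1, h2, h3⟩

/-- The base of an isosceles triangle has a midpoint. -/
theorem midpoint_of_isosceles {k : Line} {X P Q : Point} (hPQ : P ≠ Q) (hP : G.inc P k)
    (hQ : G.inc Q k) (hX : ¬ G.inc X k) (hl : G.len X P = G.len X Q) :
    ∃ F, G.btw P F Q ∧ G.len F P = G.len F Q := by
  obtain ⟨X', m⟩ := exists_mir (G := G) hX
  obtain ⟨F, hF, hb⟩ := m.opp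
  have key : ∀ {P Q : Point}, P ≠ Q → G.inc P k → G.inc Q k → G.len X P = G.len X Q →
      F ∈ G.ray P Q → G.btw P F Q ∧ G.len F P = G.len F Q := by
    intro P Q hPQ hP hQ hl hr
    -- `E` copies `F` from the other end of the base. Congruent triangles make the line `XE`
    -- perpendicular to `k`, so `E` is also the foot of `X`, and `E = F`.
    obtain ⟨E, hE, lE⟩ := exists_len (G := G) hr.1.symm hPQ
    have hEk := ray_inc hPQ hE hQ hP
    have nX := not_collinear_reverse (not_collinear hPQ.symm hQ hP hX)
    have i := isosceles nX hl
    have e1 := (ne_of_inc hP hX).symm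
    have e2 := (ne_of_inc hQ hX).symm
    rw [← angle_eq e1 hPQ.symm (mem_ray_self e1) hr, ← angle_eq e2 hPQ (mem_ray_self e2) hE] at i
    have nF := not_collinear hr.1.symm hP hF hX
    have nE := not_collinear hE.1.symm hQ hEk hX
    have s := sas (A := P) (B := X) (C := F) (A' := Q) (B' := X) (C' := E) (by grind [Collinear])
      (by grind [Collinear]) (by grind [len_comm]) lE.symm i
    have hXE := (ne_of_inc hEk hX).symm
    obtain ⟨Y, hY, lY⟩ := exists_len_btw (G := G) hXE.symm hXE
    have a := s.2.2
    rw [angle_comm, angle_comm Q] at a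
    have nXF : ¬ G.Collinear X F P := by grind [Collinear]
    have nXE : ¬ G.Collinear X E Q := by grind [Collinear]
    have a' := supplement nXF nXE a hb hY
    have := m.len F hF
    have s' := sas (not_collinear_swap (not_collinear_opposite hb nXF))
      (not_collinear_swap (not_collinear_opposite hY nXE)) (by grind [len_comm])
      (by grind [len_comm]) a'
    have := m.len P hP
    have hY' : G.Mir k X Y := by
      refine mir_of_isosceles hY lY.symm (by grind [len_comm]) ?_ hEk hQ
      have := btw_collinear hY
      have := btw_ne hY
      grind [Collinear, line_unique]
    obtain rfl := m.unique hY'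
    have : F = E := by
      have := btw_collinear hY
      have := btw_collinear hb
      have := m.ne
      grind [Collinear, line_unique]
    subst this
    refine ⟨?_, by grind [len_comm]⟩
    rcases btw_trichotomy ⟨k, hP, hF, hQ⟩ hr.1.symm hE.1 hPQ with h | h | h
    · exact h
    · exact absurd h hr.2.2
    · exact absurd (btw_symm h) hE.2.2
  by_cases h1 : F ∈ G.ray P Q
  · exact ⟨F, key hPQ hP hQ hl h1⟩
  have h2 : F ∈ G.ray Q P := by
    by_cases hFP : F = P
    · subst hFP; exact mem_ray_self hPQ
    have h := (mem_ray_or_btw hP hQ hF hFP).resolve_left h1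
    exact btw_mem_ray (btw_symm h)
  obtain ⟨h3, h4⟩ := key hPQ.symm hQ hP hl.symm h2
  exact ⟨F, btw_symm h3, h4.symm⟩

/-- The diagonals of a trapezoid intersect. -/
theorem exists_diagonal_inter {k p q : Line} {P Q S T : Point} (hPQ : P ≠ Q) (hPk : G.inc P k)
    (hQk : G.inc Q k) (hPp : G.inc P p) (hSp : G.inc S p) (hQq : G.inc Q q) (hTq : G.inc T q)
    (hpq : ∀ Z, G.inc Z p → ¬ G.inc Z q) (hS : ¬ G.inc S k) (hT : ¬ G.inc T k)
    (hST : ¬ G.Opp k S T) : ∃ X, G.btw Q X S ∧ X ∈ G.ray P T := by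
  obtain ⟨m, hPm, hTm⟩ := exists_line (G := G) (ne_of_inc hPk hT)
  obtain ⟨R, hR⟩ := btw_extend (G := G) hPQ.symm
  have hQp : ¬ G.inc Q p := fun h => hpq Q h hQq
  have hTp : ¬ G.inc T p := fun h => hpq T h hTq
  have hmp : m ≠ p := by rintro rfl; exact hTp hTm
  have hmk : m ≠ k := by rintro rfl; exact hT hTm
  have hSm : ¬ G.inc S m := fun h => ne_of_inc hPk hS (inter_unique hmp hPm hPp h hSp)
  have hQm : ¬ G.inc Q m := fun h => hPQ (inter_unique hmk hPm hPk h hQk)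
  have hRk := btw_inc_right hR hQk hPk
  have hRm : ¬ G.inc R m := fun h => hQm (btw_inc_left hR hPm h)
  have hRp : ¬ G.inc R p := fun h => hQp (btw_inc_left hR hPp h)
  have hQT : ¬ G.Opp p Q T := by
    rintro ⟨Z, hZ, hb⟩
    exact hpq Z hZ (btw_inc_mid hb hQq hTq)
  -- A point `Y` of `m` between `R` and `S` would be separated from `T` by `p`, hence by `P` on `m`,
  -- although `k` separates neither `Y` from `S` nor `S` from `T`.
  have hRS : ¬ G.Opp m R S := by
    rintro ⟨Y, hY, hb⟩
    have hYk : ¬ G.inc Y k := fun h => hS (btw_inc_right hb hRk h)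
    have hYp : ¬ G.inc Y p := fun h => hRp (btw_inc_left hb h hSp)
    have h1 := (not_opp_of_btw hYk hRk hb).2
    have h2 := (not_opp_of_btw hYp hSp (btw_symm hb)).2
    have h3 : G.Opp p T R := (opp_split hQp hRp hTp ⟨P, hPp, hR⟩).resolve_left hQT |>.symm
    have h4 := opp_of_opp_of_same hTp hRp hYp h3 (fun o => h2 o.symm)
    rw [opp_iff_btw hPp hPm hTm hY hmp.symm] at h4
    exact same_trans hYk hS hT h1 hST ⟨P, hPk, btw_symm h4⟩
  obtain ⟨X, hX, hb⟩ := opp_of_opp_of_same hQm hRm hSm ⟨P, hPm, hR⟩ hRS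
  have hXp : ¬ G.inc X p := fun h => hQp (btw_inc_left hb h hSp)
  refine ⟨X, hb, (ne_of_inc hPp hXp).symm, ⟨m, hPm, hTm, hX⟩, fun h => ?_⟩
  have h1 := (not_opp_of_btw hXp hSp (btw_symm hb)).2
  exact same_trans hXp hQp hTp h1 hQT ⟨P, hPp, h⟩

theorem len_eq_of_base_angles {k : Line} {P Q X : Point} (hPQ : P ≠ Q) (hP : G.inc P k)
    (hQ : G.inc Q k) (hX : ¬ G.inc X k) (h1 : G.angCongr (G.angle P Q X) (G.angle Q P X))
    (h2 : G.angCongr (G.angle Q P X) (G.angle P Q X)) : G.len X P = G.len X Q := by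
  have hXP := (ne_of_inc hP hX).symm
  obtain ⟨Y, hY, lY⟩ := exists_len (G := G) (ne_of_inc hQ hX) hXP
  obtain ⟨hYk, hop⟩ := not_opp_of_mem_ray hP hX hY
  rw [← angle_eq hPQ.symm hXP (mem_ray_self hPQ.symm) hY] at h1
  have a := sas_angle (not_collinear hPQ.symm hQ hP hX) (not_collinear hPQ hP hQ hYk)
    (len_comm _ _) lY.symm h1
  have := angle_unique (not_collinear hPQ.symm hQ hP hX) hPQ hQ hP hX hYk hop h2 a
  have : Y = X := by
    have h3 := this.2.1
    have h4 := hY.2.1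
    grind [Collinear, line_unique]
  subst this
  grind [len_comm]

/-- Any two points are mirror images in some line. -/
theorem exists_mirror {P Q : Point} (hPQ : P ≠ Q) : ∃ g, G.Mir g P Q := by
  obtain ⟨k, hP, hQ⟩ := exists_line (G := G) hPQ
  obtain ⟨U, hU⟩ := exists_not_inc (G := G) k
  obtain ⟨Q₁, bQ, lQ⟩ := exists_len_btw (G := G) hPQ hPQ.symm
  obtain ⟨P₁, bP, lP⟩ := exists_len_btw (G := G) hPQ.symm hPQ
  -- Equal perpendiculars `PS` and `QT` are erected on `PQ`. Their diagonals meet in a point `X`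
  -- with equal base angles, and the mirror joins `X` to the midpoint of `PQ`.
  obtain ⟨S, hS, hUS, lS⟩ := exists_right bQ lQ.symm hQ hP hU
  have nS := not_collinear hPQ.symm hQ hP hS
  obtain ⟨T, hT, hST, lT, lTP, a1⟩ := transport_right nS bQ lQ.symm lS bP lP.symm
    (len_comm _ _) hP hQ hS
  have nT := not_collinear hPQ hP hQ hT
  -- Carrying the right angle back to `P` returns `S`; this supplies the reverse congruence that
  -- symmetry of angle congruence would give.
  obtain ⟨S', hS', hTS', lS', lSQ, a2⟩ := transport_right nT bP lP.symm lTP bQ lQ.symm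
    (len_comm _ _) hQ hP hT
  obtain ⟨p, hPp, hSp⟩ := exists_line (G := G) (ne_of_inc hP hS)
  obtain ⟨q, hQq, hTq⟩ := exists_line (G := G) (ne_of_inc hQ hT)
  have c1 := btw_collinear bQ
  have c2 := btw_collinear bP
  have d1 := btw_ne bQ
  have d2 := btw_ne bP
  have mp : G.Mir p Q Q₁ := mir_of_isosceles bQ lQ.symm lS
    (by grind [Collinear, line_unique]) hPp hSp
  have mq : G.Mir q P P₁ := mir_of_isosceles bP lP.symm lTP
    (by grind [Collinear, line_unique]) hQq hTq
  have hS'p : G.inc S' p := mp.inc_of_len lSQ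
  have hSS' : S = S' := by
    have hSP := (ne_of_inc hP hS).symm
    refine eq_of_len_of_mem_ray hSP (mem_ray_self hSP) ?_ (by rw [lS', lT])
    refine (mem_ray_or_btw hPp hSp hS'p (ne_of_inc hP hS').symm).resolve_right fun h => ?_
    exact same_trans hS hT hS' hST hTS' ⟨P, hP, btw_symm h⟩
  subst hSS'
  have a3 := sas (not_collinear_swap nS) (not_collinear_swap nT) (len_comm _ _) lT.symm a1
  have a4 := sas (not_collinear_swap nT) (not_collinear_swap nS) (len_comm _ _) lT a2
  have hpk : p ≠ k := by rintro rfl; exact hS hSp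
  have hqk : q ≠ k := by rintro rfl; exact hT hTq
  have hpq : ∀ Z, G.inc Z p → ¬ G.inc Z q := by
    -- The mirror image in `k` of a common point would be a second common point, forcing `p = q`.
    intro Z hZp hZq
    have hZ : ¬ G.inc Z k := fun hZ =>
      hPQ ((inter_unique hpk hPp hP hZp hZ).trans (inter_unique hqk hZq hZ hQq hQ))
    obtain ⟨Z', m⟩ := exists_mir (G := G) hZ
    have hQ₁ := btw_inc_right bQ hQ hP
    have hP₁ := btw_inc_right bP hP hQ
    have h1 : G.inc Z' p := by
      refine mp.inc_of_len ?_
      have := m.len Q hQ; have := m.len Q₁ hQ₁; have := mp.len Z hZp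
      grind [len_comm]
    have h2 : G.inc Z' q := by
      refine mq.inc_of_len ?_
      have := m.len P hP; have := m.len P₁ hP₁; have := mq.len Z hZq
      grind [len_comm]
    exact mp.left (line_unique m.ne hZq h2 hZp h1 ▸ hQq)
  obtain ⟨X, hb, hr⟩ := exists_diagonal_inter hPQ hP hQ hPp hSp hQq hTq hpq hS hT hST
  have hX := (not_opp_of_mem_ray hP hT hr).1
  have hSQ := (ne_of_inc hQ hS).symm
  have hTP := (ne_of_inc hP hT).symm
  have b1 := a3.2.1
  have b2 := a4.2.1
  rw [← angle_eq hPQ hSQ (mem_ray_self hPQ) (btw_mem_ray' hb),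
    ← angle_eq hPQ.symm hTP (mem_ray_self hPQ.symm) hr] at b1 b2
  have hl := len_eq_of_base_angles hPQ hP hQ hX b1 b2
  obtain ⟨F, hF, lF⟩ := midpoint_of_isosceles hPQ hP hQ hX hl
  obtain ⟨g, h1, h2⟩ := exists_line (G := G) (ne_of_inc (btw_inc_mid hF hP hQ) hX)
  exact ⟨g, mir_of_isosceles hF lF hl (not_collinear hPQ hP hQ hX) h1 h2⟩

end Midpoint

/-! ### Reflections as permutations, and the three reflections theorem. -/

section Reflection

set_option linter.unusedSectionVars false

variable {Point Line : Type*} {G : PlaneGeometry Point Line} [HilbertPlane G]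

open Classical in
/-- The mirror image of a point in the line `g`. -/
noncomputable def reflFun (G : PlaneGeometry Point Line) [HilbertPlane G] (g : Line) (X : Point) :
    Point :=
  if h : G.inc X g then X else (exists_mir h).choose

theorem reflFun_of_inc {g : Line} {X : Point} (h : G.inc X g) : G.reflFun g X = X := by
  simp [reflFun, h]

theorem mir_reflFun {g : Line} {X : Point} (h : ¬ G.inc X g) : G.Mir g X (G.reflFun g X) := by
  simp only [reflFun, h, dite_false]
  exact (exists_mir h).choose_spec

theorem reflFun_involutive (g : Line) : Function.Involutive (G.reflFun g) := by
  intro X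
  by_cases h : G.inc X g
  · rw [reflFun_of_inc h, reflFun_of_inc h]
  · have m := mir_reflFun h
    exact (mir_reflFun m.right).unique m.symm

/-- The reflection in the line `g`. -/
noncomputable def refl (G : PlaneGeometry Point Line) [HilbertPlane G] (g : Line) :
    Equiv.Perm Point :=
  (reflFun_involutive (G := G) g).toPerm

theorem refl_of_inc {g : Line} {X : Point} (h : G.inc X g) : G.refl g X = X :=
  reflFun_of_inc h

theorem mir_refl {g : Line} {X : Point} (h : ¬ G.inc X g) : G.Mir g X (G.refl g X) :=
  mir_reflFun h

theorem Mir.refl_eq {g : Line} {X Y : Point} (h : G.Mir g X Y) : G.refl g X = Y :=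
  (mir_refl h.left).unique h

theorem refl_refl (g : Line) (X : Point) : G.refl g (G.refl g X) = X :=
  reflFun_involutive g X

@[simp] theorem refl_mul_self (g : Line) : G.refl g * G.refl g = 1 :=
  Equiv.ext fun X => refl_refl g X

@[simp] theorem refl_mul_cancel (g : Line) (φ : Equiv.Perm Point) :
    G.refl g * (G.refl g * φ) = φ := by
  rw [← mul_assoc, refl_mul_self, one_mul]

@[simp] theorem refl_inv (g : Line) : (G.refl g)⁻¹ = G.refl g :=
  inv_eq_of_mul_eq_one_left (refl_mul_self g)

theorem refl_eq_self_iff {g : Line} {X : Point} : G.refl g X = X ↔ G.inc X g := by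
  refine ⟨fun h => ?_, refl_of_inc⟩
  by_contra h'
  exact (mir_refl h').ne h.symm

theorem mir_of_refl {g : Line} {X Y : Point} (h : G.refl g X = Y) (hXY : X ≠ Y) : G.Mir g X Y := by
  subst h
  exact mir_refl fun h => hXY (refl_of_inc h).symm

theorem inc_iff_len {g : Line} {A B X : Point} (h : G.Mir g A B) :
    G.inc X g ↔ G.len X A = G.len X B :=
  ⟨h.len X, h.inc_of_len⟩

theorem Mir.line_unique {g h : Line} {A B : Point} (m : G.Mir g A B) (m' : G.Mir h A B) : g = h :=
  line_ext fun _ hX => m'.inc_of_len (m.len _ hX)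

/-- A permutation of the points that preserves lengths. -/
def IsIsom (G : PlaneGeometry Point Line) (φ : Equiv.Perm Point) : Prop :=
  ∀ A B, G.len (φ A) (φ B) = G.len A B

theorem isIsom_refl (g : Line) : G.IsIsom (G.refl g) := by
  intro A B
  by_cases hA : G.inc A g
  · rw [refl_of_inc hA]
    by_cases hB : G.inc B g
    · rw [refl_of_inc hB]
    · exact ((mir_refl hB).len A hA).symm
  · by_cases hB : G.inc B g
    · rw [refl_of_inc hB, len_comm, len_comm A]
      exact ((mir_refl hA).len B hB).symm
    · exact ((mir_refl hA).len_eq (mir_refl hB)).symm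

theorem IsIsom.mul {φ ψ : Equiv.Perm Point} (h : G.IsIsom φ) (h' : G.IsIsom ψ) :
    G.IsIsom (φ * ψ) := fun A B => (h _ _).trans (h' A B)

theorem exists_mir_of_line (g : Line) : ∃ A B, G.Mir g A B := by
  obtain ⟨P, hP⟩ := exists_not_inc (G := G) g
  exact ⟨P, _, mir_refl hP⟩

theorem refl_ne_one (g : Line) : G.refl g ≠ 1 := by
  obtain ⟨A, B, m⟩ := exists_mir_of_line (G := G) g
  intro h
  have := m.refl_eq
  rw [h] at this
  exact m.ne this

theorem refl_injective {g h : Line} (H : G.refl g = G.refl h) : g = h :=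
  line_ext fun X hX => refl_eq_self_iff.1 (by rw [← H]; exact refl_of_inc hX)

/-- Isometries map lines to lines. -/
theorem IsIsom.exists_image {φ : Equiv.Perm Point} (h : G.IsIsom φ) (g : Line) :
    ∃ k, (∀ X, G.inc (φ X) k ↔ G.inc X g) ∧ φ * G.refl g * φ⁻¹ = G.refl k := by
  obtain ⟨A, B, m⟩ := exists_mir_of_line (G := G) g
  -- A line is the locus of points equidistant from a mirrored pair, so preserving lengths already
  -- suffices.
  obtain ⟨k, mk⟩ := exists_mirror (G := G) (φ.injective.ne m.ne)
  have hk : ∀ X, G.inc (φ X) k ↔ G.inc X g := fun X => by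
    rw [inc_iff_len mk, inc_iff_len m, h, h]
  refine ⟨k, hk, Equiv.ext fun Y => ?_⟩
  obtain ⟨X, rfl⟩ := φ.surjective Y
  have e : (φ * G.refl g * φ⁻¹) (φ X) = φ (G.refl g X) := by simp
  rw [e]
  by_cases hX : G.inc X g
  · rw [refl_of_inc hX, refl_of_inc ((hk X).2 hX)]
  · have mX := mir_refl hX
    obtain ⟨k', mk'⟩ := exists_mirror (G := G) (φ.injective.ne mX.ne)
    have : k' = k := line_ext fun Y hY => by
      obtain ⟨Z, rfl⟩ := φ.surjective Y
      rw [hk, inc_iff_len mX, ← h Z X, ← h Z (G.refl g X)]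
      exact mk'.len _ hY
    rw [← this, mk'.refl_eq]

/-- If an isometry fixing `A` and `B` moves `C`, the bisector of `C` and its image contains `A` and
`B`, so it is `g`. If `φ` moves `C`, then `refl g * φ` fixes `C` too; were it to move some point,
`C` would lie on `g`. -/
theorem IsIsom.eq_one_or_refl {φ : Equiv.Perm Point} (h : G.IsIsom φ) {A B : Point} {g : Line}
    (hAB : A ≠ B) (hA : φ A = A) (hB : φ B = B) (hAg : G.inc A g) (hBg : G.inc B g) :
    φ = 1 ∨ φ = G.refl g := by
  have key : ∀ ψ : Equiv.Perm Point, G.IsIsom ψ → ψ A = A → ψ B = B → ∀ C, ψ C ≠ C →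
      G.Mir g C (ψ C) := by
    intro ψ h hA hB C hC
    obtain ⟨k, m⟩ := exists_mirror (G := G) hC.symm
    have h1 : G.inc A k := m.inc_of_len (by conv_rhs => rw [← hA, h])
    have h2 : G.inc B k := m.inc_of_len (by conv_rhs => rw [← hB, h])
    rwa [line_unique hAB hAg hBg h1 h2]
  by_cases h1 : φ = 1
  · exact Or.inl h1
  obtain ⟨C, hC⟩ : ∃ C, φ C ≠ C := by
    by_contra! H
    exact h1 (Equiv.ext H)
  have m := key φ h hA hB C hC
  refine Or.inr ?_
  have h2 : G.refl g * φ = 1 := by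
    by_contra hne
    obtain ⟨D, hD⟩ : ∃ D, (G.refl g * φ) D ≠ D := by
      by_contra! H
      exact hne (Equiv.ext H)
    have i := (isIsom_refl g).mul h
    have eC : (G.refl g * φ) C = C := by
      rw [Equiv.Perm.mul_apply]; exact m.symm.refl_eq
    have m' := key _ i (by rw [Equiv.Perm.mul_apply, hA, refl_of_inc hAg])
      (by rw [Equiv.Perm.mul_apply, hB, refl_of_inc hBg]) D hD
    exact m.left (m'.inc_of_len (by conv_rhs => rw [← eC, i]))
  rw [← refl_mul_cancel (G := G) g φ, h2, mul_one]

/-- A product of two reflections is not a reflection. -/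
theorem refl_mul_refl_ne (a b c : Line) : G.refl a * G.refl b ≠ G.refl c := by
  intro H
  have hab : a ≠ b := by
    rintro rfl
    exact refl_ne_one c (by rw [← H, refl_mul_self])
  have key : ∀ X, G.inc X c → G.inc X a ∧ G.inc X b := by
    intro X hX
    have h1 : G.refl b X = G.refl a X := by
      have : G.refl a (G.refl b X) = X := by rw [← Equiv.Perm.mul_apply, H, refl_of_inc hX]
      rw [← refl_refl (G := G) a (G.refl b X), this]
    by_cases hXa : G.inc X a
    · rw [refl_of_inc hXa, refl_eq_self_iff] at h1
      exact ⟨hXa, h1⟩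
    · have m := mir_refl hXa
      exact absurd (m.line_unique (mir_of_refl h1 m.ne)) hab
  exact hab ((line_ext fun X hX => (key X hX).1).symm.trans (line_ext fun X hX => (key X hX).2))

/-- The theorem of the three reflections for concurrent lines. -/
theorem three_refl {a b c : Line} {M : Point} (ha : G.inc M a) (hb : G.inc M b) (hc : G.inc M c) :
    ∃ d, G.inc M d ∧ G.refl a * G.refl b * G.refl c = G.refl d := by
  obtain ⟨X, hX, hXc⟩ := exists_inc_ne (G := G) c M
  have hi : G.IsIsom (G.refl a * G.refl b) := (isIsom_refl a).mul (isIsom_refl b)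
  have eM : (G.refl a * G.refl b) M = M := by
    rw [Equiv.Perm.mul_apply, refl_of_inc hb, refl_of_inc ha]
  -- `d` brings the image of `X` under `ab` back to `X`. Then `d * (ab) * c` fixes `c` pointwise at
  -- `M` and `X`, so it is `1` or the reflection in `c`; the latter would make `ab` a reflection.
  obtain ⟨d, hd, hdX⟩ : ∃ d, G.inc M d ∧ G.refl d ((G.refl a * G.refl b) X) = X := by
    by_cases h : (G.refl a * G.refl b) X = X
    · exact ⟨c, hc, by rw [h, refl_of_inc hXc]⟩
    · obtain ⟨d, m⟩ := exists_mirror (G := G) h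
      exact ⟨d, m.inc_of_len (by conv_lhs => rw [← eM, hi]), m.refl_eq⟩
  refine ⟨d, hd, ?_⟩
  have hj := ((isIsom_refl d).mul hi).mul (isIsom_refl c)
  have h1 := hj.eq_one_or_refl hX (g := c)
    (by rw [Equiv.Perm.mul_apply, refl_of_inc hXc, Equiv.Perm.mul_apply, hdX])
    (by rw [Equiv.Perm.mul_apply, refl_of_inc hc, Equiv.Perm.mul_apply, eM, refl_of_inc hd]) hXc hc
  rcases h1 with h | h
  · rw [mul_assoc, mul_eq_one_iff_inv_eq, refl_inv] at h
    exact h.symm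
  · rw [mul_eq_right, mul_eq_one_iff_inv_eq, refl_inv] at h
    exact absurd h.symm (refl_mul_refl_ne a b d)

/-- Two lines are perpendicular if they are distinct and their reflections commute. -/
def Perp (G : PlaneGeometry Point Line) [HilbertPlane G] (g h : Line) : Prop :=
  g ≠ h ∧ G.refl g * G.refl h = G.refl h * G.refl g

theorem Perp.symm {g h : Line} (H : G.Perp g h) : G.Perp h g := ⟨H.1.symm, H.2.symm⟩

theorem Perp.inc_refl {g h : Line} (H : G.Perp g h) {X : Point} (hX : G.inc X h) :
    G.inc (G.refl g X) h := by
  rw [← refl_eq_self_iff, ← Equiv.Perm.mul_apply, ← H.2, Equiv.Perm.mul_apply, refl_of_inc hX]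

theorem Mir.perp {g h : Line} {A B : Point} (m : G.Mir g A B) (hA : G.inc A h) (hB : G.inc B h) :
    G.Perp g h := by
  refine ⟨by rintro rfl; exact m.left hA, ?_⟩
  obtain ⟨k, hk, e⟩ := (isIsom_refl (G := G) g).exists_image h
  have h1 := (hk A).2 hA
  have h2 := (hk B).2 hB
  rw [m.refl_eq] at h1
  rw [m.symm.refl_eq] at h2
  rw [PlaneGeometry.line_unique m.ne h2 h1 hA hB, refl_inv, mul_assoc] at e
  rw [← e, mul_assoc, mul_assoc, refl_mul_self, mul_one, e]

theorem Perp.exists_inter {g h : Line} (H : G.Perp g h) : ∃ F, G.inc F g ∧ G.inc F h := by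
  obtain ⟨X, hX, hXg⟩ : ∃ X, G.inc X h ∧ ¬ G.inc X g := by
    by_contra! H'
    exact H.1 (line_ext H').symm
  obtain ⟨F, hF, hb⟩ := (mir_refl hXg).opp
  exact ⟨F, hF, btw_inc_mid hb hX (H.inc_refl hX)⟩

theorem exists_perp (g : Line) (P : Point) : ∃ h, G.inc P h ∧ G.Perp h g := by
  by_cases hP : G.inc P g
  · obtain ⟨A, hA, hAg⟩ := exists_inc_ne (G := G) g P
    obtain ⟨B, hB, l⟩ := exists_len_btw (G := G) hA.symm hA
    obtain ⟨m, hm⟩ := exists_mirror (G := G) (btw_ne hB)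
    exact ⟨m, hm.inc_of_len l.symm, hm.perp hAg (btw_inc_right hB hAg hP)⟩
  · have m := mir_refl hP
    obtain ⟨h, h1, h2⟩ := exists_line (G := G) m.ne
    exact ⟨h, h1, (m.perp h1 h2).symm⟩

theorem perp_unique {g h k : Line} {P : Point} (hh : G.Perp h g) (hk : G.Perp k g)
    (hPh : G.inc P h) (hPk : G.inc P k) : h = k := by
  by_cases hP : G.inc P g
  · obtain ⟨A, hA, hAg⟩ := exists_inc_ne (G := G) g P
    have key : ∀ {h}, G.Perp h g → G.inc P h → G.Mir h A (G.refl h A) ∧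
        G.btw A P (G.refl h A) ∧ G.len P (G.refl h A) = G.len P A := by
      intro h hh hPh
      have m := mir_refl (G := G) (g := h) (X := A)
        fun h' => hA (inter_unique hh.1 h' hAg hPh hP)
      obtain ⟨F, hF, hb⟩ := m.opp
      obtain rfl := inter_unique hh.1 hF (btw_inc_mid hb hAg (hh.inc_refl hAg)) hPh hP
      exact ⟨m, hb, (m.len F hF).symm⟩
    obtain ⟨m1, b1, l1⟩ := key hh hPh
    obtain ⟨m2, b2, l2⟩ := key hk hPk
    have hne := (btw_ne_right b1).symm
    have := eq_of_len_of_mem_ray hne (mem_ray_self hne) (mem_ray_of_btw_btw b1 b2)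
      (l1.trans l2.symm)
    rw [← this] at m2
    exact m1.line_unique m2
  · exact line_unique (mir_refl hP).ne hPh (hh.symm.inc_refl hPh) hPk (hk.symm.inc_refl hPk)

/-- A half turn about `N` is the product of the reflections in any two perpendicular lines
through `N`. -/
theorem half_turn_unique {a b c d : Line} {N : Point} (hab : G.Perp a b) (hcd : G.Perp c d)
    (ha : G.inc N a) (hb : G.inc N b) (hc : G.inc N c) (hd : G.inc N d) :
    G.refl a * G.refl b = G.refl c * G.refl d := by
  -- `l` satisfies `ab = cl`. As `ab` is an involution, `c` and `l` commute, so `l` is the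
  -- perpendicular `d`.
  obtain ⟨l, hl, e⟩ := three_refl hc ha hb
  have e' : G.refl a * G.refl b = G.refl c * G.refl l := by
    rw [← e, mul_assoc, refl_mul_cancel]
  have hp : G.Perp l c := by
    refine ⟨?_, ?_⟩
    · rintro rfl
      rw [refl_mul_self, mul_eq_one_iff_inv_eq, refl_inv] at e'
      exact hab.1 (refl_injective e')
    · have := congrArg (·⁻¹) e'
      simp only [mul_inv_rev, refl_inv] at this
      rw [← this, ← hab.2, e']
  rw [e', perp_unique hp hcd.symm hl hd]

end Reflection

/-! ### Directions of lines in the presence of the parallel postulate. -/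

/-- A plane satisfying Hilbert's axioms I to IV. -/
class EuclideanPlane {Point Line : Type*} (G : PlaneGeometry Point Line) : Prop
    extends HilbertPlane G where
  parallel : G.ParallelAxiom

section Euclidean

set_option linter.unusedSectionVars false

variable {Point Line : Type*} {G : PlaneGeometry Point Line} [EuclideanPlane G]

/-- Two lines have the same direction if they are equal or parallel. -/
def Par (G : PlaneGeometry Point Line) (g h : Line) : Prop := g = h ∨ G.Parallel g h

theorem Par.symm {g h : Line} (H : G.Par g h) : G.Par h g :=
  H.imp Eq.symm fun H X hX => H X hX.symm

theorem Par.eq_of_inc {g h : Line} {P : Point} (H : G.Par g h) (h1 : G.inc P g)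
    (h2 : G.inc P h) : g = h :=
  H.resolve_right fun H => H P ⟨h1, h2⟩

theorem exists_inter {g h : Line} (H : ¬ G.Par g h) : ∃ P, G.inc P g ∧ G.inc P h := by
  by_contra! H'
  exact H (Or.inr fun X hX => H' X hX.1 hX.2)

theorem par_of_perp {g h k : Line} (hg : G.Perp g k) (hh : G.Perp h k) : G.Par g h := by
  by_contra H
  obtain ⟨P, h1, h2⟩ := exists_inter H
  exact H (Or.inl (perp_unique hg hh h1 h2))

/-- The only direct use of the parallel postulate: once to make `k` meet `h`, once to identify `h`
with the perpendicular to `k` at that point. -/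
theorem Perp.of_par {g h k : Line} (hg : G.Perp g k) (H : G.Par g h) : G.Perp h k := by
  rcases H with rfl | H
  · exact hg
  obtain ⟨F, hF, hFk⟩ := hg.exists_inter
  have hFh : ¬ G.inc F h := fun h' => H F ⟨hF, h'⟩
  obtain ⟨P, hPk, hPh⟩ : ∃ P, G.inc P k ∧ G.inc P h := by
    by_contra! H'
    exact hg.1 (EuclideanPlane.parallel F h g k hFh hF hFk (fun X hX => H X hX.symm)
      fun X hX => H' X hX.2 hX.1)
  have hPg : ¬ G.inc P g := fun h' => H P ⟨h', hPh⟩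
  obtain ⟨m, hPm, hm⟩ := exists_perp (G := G) k P
  have hgm : G.Parallel g m :=
    (par_of_perp hg hm).resolve_left (by rintro rfl; exact hPg hPm)
  rwa [EuclideanPlane.parallel P g h m hPg hPh hPm H hgm]

theorem Par.trans {a b c : Line} (h1 : G.Par a b) (h2 : G.Par b c) : G.Par a c := by
  obtain ⟨g⟩ := HilbertPlane.nonempty_line (G := G)
  obtain ⟨P, -⟩ := HilbertPlane.incidence (G := G).two_points g
  obtain ⟨k, -, hk⟩ := exists_perp (G := G) b P
  exact par_of_perp (hk.symm.of_par h1.symm) (hk.symm.of_par h2)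

theorem exists_par (O : Point) (g : Line) : ∃ h, G.inc O h ∧ G.Par g h := by
  obtain ⟨k, -, hk⟩ := exists_perp (G := G) g O
  obtain ⟨h, hO, hh⟩ := exists_perp (G := G) k O
  exact ⟨h, hO, par_of_perp hk.symm hh⟩

/-- Any point can be carried to any other one by an isometry that preserves the directions of
lines. -/
theorem exists_isom_par (M O : Point) : ∃ τ : Equiv.Perm Point, G.IsIsom τ ∧ τ M = O ∧
    ∀ g h, τ * G.refl g * τ⁻¹ = G.refl h → G.Par g h := by
  by_cases hMO : M = O
  · refine ⟨1, fun _ _ => rfl, hMO, fun g h H => Or.inl (refl_injective (G := G) ?_)⟩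
    simpa using H
  obtain ⟨m, hm⟩ := exists_mirror (G := G) hMO
  obtain ⟨n, hMn, hOn⟩ := exists_line (G := G) hMO
  have hmn := hm.perp hMn hOn
  obtain ⟨N, hNm, hNn⟩ := hmn.exists_inter
  -- The half turn about the midpoint `N` of `MO`. Rewritten as `lk` with `k` perpendicular to `g`,
  -- it sends `g` to its reflection in `l`, which is again perpendicular to `k`.
  refine ⟨G.refl m * G.refl n, (isIsom_refl m).mul (isIsom_refl n), ?_, fun g h H => ?_⟩
  · rw [Equiv.Perm.mul_apply, refl_of_inc hMn, hm.refl_eq]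
  obtain ⟨k, hNk, hk⟩ := exists_perp (G := G) g N
  obtain ⟨l, hNl, hl⟩ := exists_perp (G := G) k N
  rw [half_turn_unique hmn hl hNm hNn hNl hNk, mul_inv_rev, refl_inv, refl_inv] at H
  have H' : G.refl l * G.refl g * G.refl l = G.refl h := by
    rw [← H, mul_assoc (G.refl l) (G.refl k), hk.2]
    simp [mul_assoc]
  refine par_of_perp hk.symm ⟨?_, ?_⟩
  · rintro rfl
    refine hk.1 (refl_injective (G := G) ?_)
    rw [mul_assoc, ← mul_right_inj (G.refl l), refl_mul_cancel, hl.2,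
      mul_left_inj] at H'
    exact H'.symm
  · rw [← H']
    have e1 := hl.2
    have e2 := hk.2
    calc G.refl l * G.refl g * G.refl l * G.refl k
        = G.refl l * (G.refl g * (G.refl l * G.refl k)) := by simp [mul_assoc]
      _ = G.refl l * (G.refl g * G.refl k) * G.refl l := by rw [e1]; simp [mul_assoc]
      _ = G.refl l * G.refl k * G.refl g * G.refl l := by rw [← e2]; simp [mul_assoc]
      _ = _ := by rw [e1]; simp [mul_assoc]

/-- Relations between three reflections in concurrent lines depend only on the directions of the
lines. -/
theorem three_refl_par {M O : Point} {a b c d a' b' c' d' : Line} (ha : G.inc M a)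
    (hb : G.inc M b) (hc : G.inc M c) (hd : G.inc M d) (ha' : G.inc O a') (hb' : G.inc O b')
    (hc' : G.inc O c') (hd' : G.inc O d') (pa : G.Par a a') (pb : G.Par b b') (pc : G.Par c c')
    (pd : G.Par d d') (H : G.refl a * G.refl b * G.refl c = G.refl d) :
    G.refl a' * G.refl b' * G.refl c' = G.refl d' := by
  obtain ⟨τ, hτ, hM, hp⟩ := exists_isom_par (G := G) M O
  have key : ∀ {a a'}, G.inc M a → G.inc O a' → G.Par a a' →
      τ * G.refl a * τ⁻¹ = G.refl a' := by
    intro a a' ha ha' pa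
    obtain ⟨k, hk, e⟩ := hτ.exists_image a
    have hO := (hk M).2 ha
    rw [hM] at hO
    rw [e, (pa.symm.trans (hp _ _ e)).eq_of_inc ha' hO]
  rw [← key ha ha' pa, ← key hb hb' pb, ← key hc hc' pc, ← key hd hd' pd, ← H]
  simp [mul_assoc]

/-! ### Antiparallels and concyclic points. -/

/-- If `X`, `Y` on `g` and `Z`, `W` on `g'` are concyclic, then the lines `XZ` and `YW` are
antiparallel with respect to `g` and `g'`. Directions are measured at the point `O`. -/
theorem antiparallel_of_concyclic {O M X Y Z W : Point} {g g' x y b g₀ g₀' u v : Line}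
    (hXY : X ≠ Y) (hX : G.inc X g) (hY : G.inc Y g) (hMb : G.inc M b) (hb : G.Perp b g')
    (hZW : G.refl b Z = W) (hXZ : X ≠ Z) (hYW : Y ≠ W) (hXx : G.inc X x) (hZx : G.inc Z x)
    (hYy : G.inc Y y) (hWy : G.inc W y) (l1 : G.len M X = G.len M Y) (l2 : G.len M X = G.len M Z)
    (pg : G.Par g g₀) (pg' : G.Par g' g₀') (px : G.Par x u) (py : G.Par y v)
    (hg₀ : G.inc O g₀) (hg₀' : G.inc O g₀') (hu : G.inc O u) (hv : G.inc O v) :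
    G.refl v * G.refl g₀ * G.refl u = G.refl g₀' := by
  obtain ⟨c, mc⟩ := exists_mirror (G := G) hXZ
  obtain ⟨d, md⟩ := exists_mirror (G := G) hYW
  have hMW : G.len M Z = G.len M W := by
    rw [← isIsom_refl b M Z, hZW, refl_of_inc hMb]
  have hMc := mc.inc_of_len l2
  have hMd := md.inc_of_len (l1.symm.trans (l2.trans hMW))
  -- The product `dbc` of reflections in lines through the centre `M` sends `X` to `Z`, `W`, `Y` in
  -- turn, so `e` is the bisector of `XY`. Assuming only `refl b Z = W` admits `Z = W`, where the
  -- circle touches `g'`.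
  obtain ⟨e, hMe, E⟩ := three_refl hMd hMb hMc
  have eX : G.refl e X = Y := by
    rw [← E, Equiv.Perm.mul_apply, mc.refl_eq, Equiv.Perm.mul_apply, hZW, md.symm.refl_eq]
  have pe := (mir_of_refl eX hXY).perp hX hY
  have pc := mc.perp hXx hZx
  have pd := md.perp hYy hWy
  obtain ⟨e₀, hOe, qe⟩ := exists_perp (G := G) g₀ O
  obtain ⟨b₀, hOb, qb⟩ := exists_perp (G := G) g₀' O
  obtain ⟨c₀, hOc, qc⟩ := exists_perp (G := G) u O
  obtain ⟨d₀, hOd, qd⟩ := exists_perp (G := G) v O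
  have key : ∀ {a g h k : Line}, G.Perp a g → G.Par g h → G.Perp k h → G.Par a k :=
    fun h1 h2 h3 => par_of_perp (h1.symm.of_par h2).symm h3
  have F := three_refl_par hMd hMb hMc hMe hOd hOb hOc hOe (key pd py qd) (key hb pg' qb)
    (key pc px qc) (key pe pg qe) E
  -- `t` is the half turn about `O`. It turns each reflection into the one in the perpendicular
  -- line, so the relation between the bisectors becomes one between the lines themselves.
  obtain ⟨t, ht⟩ : ∃ t, G.refl d₀ * G.refl v = t := ⟨_, rfl⟩
  have key' : ∀ {a h}, G.Perp a h → G.inc O a → G.inc O h →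
      G.refl a = t * G.refl h ∧ G.refl a = G.refl h * t := by
    intro a h p h1 h2
    rw [← ht, half_turn_unique qd p hOd hv h1 h2]
    exact ⟨by simp [mul_assoc], by rw [p.2]; simp⟩
  have tt : ∀ φ, t * (t * φ) = φ := fun φ => by
    rw [← mul_assoc]
    nth_rw 1 [← ht]
    rw [qd.2, ← ht]
    simp [mul_assoc]
  rw [(key' qd hOd hv).2, (key' qb hOb hg₀').1, (key' qc hOc hu).2, (key' qe hOe hg₀).2] at F
  have F' : G.refl v * G.refl g₀' * G.refl u = G.refl g₀ := by
    rw [← mul_left_inj t, ← F]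
    simp [mul_assoc, tt]
  rw [← F']
  simp [mul_assoc]

theorem refl_mul_reverse {a b c d : Line} (h : G.refl a * G.refl b * G.refl c = G.refl d) :
    G.refl c * G.refl b * G.refl a = G.refl d := by
  have := congrArg (·⁻¹) h
  simpa [mul_assoc] using this

/-- The relation of being antiparallel with respect to `g` and `g'` passes from one pair of
opposite sides of a quadrangle with vertices on `g` and `g'` to another one. -/
theorem antiparallel_swap {O X Y Z W : Point} {g g' xz yw xw yz g₀ g₀' u₁ u₂ u₃ u₄ : Line}
    (hXY : X ≠ Y) (hX : G.inc X g) (hY : G.inc Y g) (hX' : ¬ G.inc X g') (hY' : ¬ G.inc Y g')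
    (hZ : G.inc Z g') (hW : G.inc W g') (hZ' : ¬ G.inc Z g)
    (hXxz : G.inc X xz) (hZxz : G.inc Z xz) (hYyw : G.inc Y yw) (hWyw : G.inc W yw)
    (hXxw : G.inc X xw) (hWxw : G.inc W xw) (hYyz : G.inc Y yz) (hZyz : G.inc Z yz)
    (pg : G.Par g g₀) (pg' : G.Par g' g₀') (p₁ : G.Par xz u₁) (p₂ : G.Par yw u₂)
    (p₃ : G.Par xw u₃) (p₄ : G.Par yz u₄) (hg₀ : G.inc O g₀) (hg₀' : G.inc O g₀')
    (h₁ : G.inc O u₁) (h₃ : G.inc O u₃) (h₄ : G.inc O u₄)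
    (H : G.refl u₁ * G.refl g₀ * G.refl u₂ = G.refl g₀') :
    G.refl u₃ * G.refl g₀ * G.refl u₄ = G.refl g₀' := by
  have hXZ := (ne_of_inc hZ hX').symm
  obtain ⟨a, ma⟩ := exists_mirror (G := G) hXY
  obtain ⟨c, mc⟩ := exists_mirror (G := G) hXZ
  obtain ⟨M, hMa, hMc⟩ := exists_inter (G := G) (g := a) (h := c) fun h => by
    have := perp_unique ((ma.perp hX hY).of_par h).symm (mc.perp hXxz hZxz).symm hX hXxz
    exact hZ' (this ▸ hZxz)
  -- `M` is the centre of the circle through `X`, `Y`, `Z`, and `refl b Z` is its second point on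
  -- `g'`. The direct statement gives the direction of the line from `Y` to this point; it agrees
  -- with that of `YW`, so the point is `W`.
  have l1 := ma.len M hMa
  have l2 := mc.len M hMc
  obtain ⟨b, hMb, pb⟩ := exists_perp (G := G) g' M
  have hW₁ := pb.inc_refl hZ
  have hYW₁ := (ne_of_inc hW₁ hY').symm
  obtain ⟨y, hYy, hWy⟩ := exists_line (G := G) hYW₁
  obtain ⟨v, hv, py⟩ := exists_par (G := G) O y
  have A := refl_mul_reverse (antiparallel_of_concyclic hXY hX hY hMb pb rfl hXZ hYW₁ hXxz hZxz
    hYy hWy l1 l2 pg pg' p₁ py hg₀ hg₀' h₁ hv)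
  have huv : v = u₂ := by
    apply refl_injective (G := G)
    rw [← H] at A
    exact mul_left_cancel A
  have e : y = yw := (py.trans (huv ▸ p₂.symm)).eq_of_inc hYy hYyw
  have hWW : G.refl b Z = W := by
    refine inter_unique (G := G) (g := y) (h := g') ?_ hWy hW₁ (e ▸ hWyw) hW
    rintro rfl
    exact hY' hYy
  have l3 : G.len M X = G.len M W := by
    rw [l2, ← isIsom_refl b M Z, hWW, refl_of_inc hMb]
  exact refl_mul_reverse (antiparallel_of_concyclic hXY hX hY hMb pb (by rw [← hWW, refl_refl])
    (ne_of_inc hW hX').symm (ne_of_inc hZ hY').symm hXxw hWxw hYyz hZyz l1 l3 pg pg' p₃ p₄ hg₀ hg₀'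
    h₃ h₄)

end Euclidean

end PlaneGeometry

/-! ### The affine Pappus theorem. -/

open PlaneGeometry in
theorem mainTheorem10 {Point Line : Type*} (G : PlaneGeometry Point Line)
    (hI : G.IncidenceAxioms) (hII : G.OrderAxioms) (hIII : G.CongruenceAxioms)
    (hIV : G.ParallelAxiom)
    (g g' : Line) (A B C A' B' C' : Point)
    (hA : G.inc A g ∧ ¬ G.inc A g') (hB : G.inc B g ∧ ¬ G.inc B g')
    (hC : G.inc C g ∧ ¬ G.inc C g')
    (hA' : G.inc A' g' ∧ ¬ G.inc A' g) (hB' : G.inc B' g' ∧ ¬ G.inc B' g)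
    (hC' : G.inc C' g' ∧ ¬ G.inc C' g)
    (hAB : A ≠ B)
    (lBC' lB'C lAC' lA'C lAB' lA'B : Line)
    (hBC' : G.inc B lBC' ∧ G.inc C' lBC') (hB'C : G.inc B' lB'C ∧ G.inc C lB'C)
    (hAC' : G.inc A lAC' ∧ G.inc C' lAC') (hA'C : G.inc A' lA'C ∧ G.inc C lA'C)
    (hAB' : G.inc A lAB' ∧ G.inc B' lAB') (hA'B : G.inc A' lA'B ∧ G.inc B lA'B)
    (h₁ : G.Parallel lBC' lB'C) (h₂ : G.Parallel lAC' lA'C) :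
    G.Parallel lAB' lA'B := by
  have : G.EuclideanPlane :=
    { nonempty_line := ⟨g⟩, incidence := hI, order := hII, congruence := hIII, parallel := hIV }
  have hBC : B ≠ C := by rintro rfl; exact h₁ B ⟨hBC'.1, hB'C.2⟩
  have hAC : A ≠ C := by rintro rfl; exact h₂ A ⟨hAC'.1, hA'C.2⟩
  obtain ⟨g₀', hg₀', pg'⟩ := exists_par (G := G) A g'
  obtain ⟨u₁, hu₁, p₁⟩ := exists_par (G := G) A lBC'
  obtain ⟨u₂, hu₂, p₂⟩ := exists_par (G := G) A lAC'
  obtain ⟨u₃, hu₃, p₃⟩ := exists_par (G := G) A lAB'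
  obtain ⟨u₄, hu₄, p₄⟩ := exists_par (G := G) A lA'B
  have p₁' : G.Par lB'C u₁ := (Par.symm (Or.inr h₁)).trans p₁
  have p₂' : G.Par lA'C u₂ := (Par.symm (Or.inr h₂)).trans p₂
  have pg : G.Par g g := Or.inl rfl
  -- `v` is the line through `A` antiparallel to `BC'`; it will meet `g'` in the auxiliary point
  -- `D`. Directions are measured at `A`, so `g` represents itself.
  obtain ⟨v, hv, E⟩ := three_refl hg₀' hu₁ hA.1
  have pv : G.Par v v := Or.inl rfl
  have E' : G.refl v * G.refl g * G.refl u₁ = G.refl g₀' := by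
    rw [← E]
    simp [mul_assoc]
  obtain ⟨D, hDv, hD⟩ : ∃ D, G.inc D v ∧ G.inc D g' := by
    refine exists_inter fun h => ?_
    have e : v = g₀' := (h.trans pg').eq_of_inc hv hg₀'
    rw [e, mul_assoc, mul_eq_left, mul_eq_one_iff_inv_eq, refl_inv] at E'
    have := (refl_injective (G := G) E' ▸ p₁).eq_of_inc hBC'.1 hB.1
    exact hC'.2 (this ▸ hBC'.2)
  have hDg : ¬ G.inc D g := fun hDg => by
    have e := line_unique (ne_of_inc hD hA.2).symm hv hDv hA.1 hDg
    rw [e, refl_mul_self, one_mul] at E'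
    have := (p₁.trans (refl_injective (G := G) E' ▸ pg'.symm)).eq_of_inc hBC'.2 hC'.1
    exact hB.2 (this ▸ hBC'.1)
  obtain ⟨b, hBb, hDb⟩ := exists_line (G := G) (ne_of_inc hD hB.2).symm
  obtain ⟨c, hCc, hDc⟩ := exists_line (G := G) (ne_of_inc hD hC.2).symm
  obtain ⟨w, hw, pw⟩ := exists_par (G := G) A b
  obtain ⟨s, hs, ps⟩ := exists_par (G := G) A c
  have s₁ := antiparallel_swap hAB hA.1 hB.1 hA.2 hB.2 hD hC'.1 hDg hv hDv hBC'.1 hBC'.2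
    hAC'.1 hAC'.2 hBb hDb pg pg' pv p₁ p₂ pw hA.1 hg₀' hv hu₂ hw E'
  have s₂ := antiparallel_swap hBC hB.1 hC.1 hB.2 hC.2 hD hA'.1 hDg hBb hDb hA'C.2 hA'C.1
    hA'B.2 hA'B.1 hCc hDc pg pg' pw p₂' p₄ ps hA.1 hg₀' hw hu₄ hs (refl_mul_reverse s₁)
  have s₃ := antiparallel_swap hAC hA.1 hC.1 hA.2 hC.2 hD hB'.1 hDg hv hDv hB'C.2 hB'C.1
    hAB'.1 hAB'.2 hCc hDc pg pg' pv p₁' p₃ ps hA.1 hg₀' hv hu₃ hs E'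
  -- `AB'` and `A'B` are both antiparallel to `CD`.
  have e : u₃ = u₄ := by
    apply refl_injective (G := G)
    rw [← s₂, mul_assoc, mul_assoc] at s₃
    exact mul_right_cancel s₃
  refine (p₃.trans (e ▸ p₄.symm)).resolve_left ?_
  rintro rfl
  exact hB'.2 (line_unique hAB hAB'.1 hA'B.2 hA.1 hB.1 ▸ hAB'.2)
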